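/- Let $\Lambda$ be a (possibly infinite) multiset of nonnegative integers that contains $0$ exactly once and each $m\ge 1$ with finite multiplicity $\lambda_m$, and let $\Lambda(z)=1+\lambda_1z+\lambda_2z^2+\cdots$ be its generating function. A $\Lambda$-Fishburn matrix is an upper-triangular square matrix (of any dimension, the empty matrix included) whose entries are elements of $\Lambda$ (the $\lambda_m$ copies of $m$ being distinguished) and which has no zero row and no zero column; its size is the sum of its entries. Assume that $\lambda_1>0$ and that $\Lambda(z)$ has a positive radius of convergence. Then for every $n\ge 0$ the number of $\Lambda$-Fishburn matrices of size $n$ is $$[z^n]\sum_{k\ge0}\prod_{1\le j\le k}\bigl(1-\Lambda(z)^{-j}\bigr),$$ and, as $n\to\infty$, it equals $$c\,\rho^n n^{n+1}\bigl(1+O(n^{-1})\bigr),\qquad c=\frac{12\sqrt6}{\pi^2}\,e^{\frac{\pi^2}{6}\left(\frac{\lambda_2}{\lambda_1^2}-\frac12\right)},\quad \rho=\frac{6\lambda_1}{e\pi^2},$$ where the implied constant may depend on $\Lambda$. In particular (Zagier), the number of Fishburn matrices of size $n$, that is, of upper-triangular square matrices with nonnegative integer entries, no zero row, no zero column and entry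 sum $n$, equals $[z^n]\sum_{k\ge0}\prod_{1\le j\le k}\bigl(1-(1-z)^{j}\bigr)$ for every $n\ge 0$ and is $$\frac{12\sqrt6}{\pi^2}\,e^{\frac{\pi^2}{12}}\left(\frac{6}{e\pi^2}\right)^n n^{n+1}\bigl(1+O(n^{-1})\bigr)\qquad(n\to\infty).$$ -/

import Mathlib

open Filter Asymptotics

/-- A square matrix of nonnegative integers is a Fishburn matrix if it is upper-triangular and
has neither a zero row nor a zero column. The empty matrix (`k = 0`) is one. -/
def IsFishburn {k : ℕ} (M : Matrix (Fin k) (Fin k) ℕ) : Prop :=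
  M.BlockTriangular id ∧ (∀ i, ∃ j, M i j ≠ 0) ∧ (∀ j, ∃ i, M i j ≠ 0)

/-- The size of a matrix is the sum of all its entries. -/
def matrixSize {k : ℕ} (M : Matrix (Fin k) (Fin k) ℕ) : ℕ :=
  ∑ i, ∑ j, M i j

/-- The number of Fishburn matrices (of any dimension) of size `n`. -/
noncomputable def fishburnNumber (n : ℕ) : ℕ :=
  Nat.card {A : Σ k : ℕ, Matrix (Fin k) (Fin k) ℕ // IsFishburn A.2 ∧ matrixSize A.2 = n}

/-- A (possibly infinite) multiset of nonnegative integers is given by its multiplicity function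
`L : ℕ → ℕ`. Its elements are the pairs `⟨m, c⟩`, where `c` is one of the `L m` copies of `m`. -/
abbrev MultisetElt (L : ℕ → ℕ) : Type := Σ m : ℕ, Fin (L m)

/-- The matrix of the values of the entries, forgetting which copy is used. -/
def entryValues {L : ℕ → ℕ} {k : ℕ} (A : Matrix (Fin k) (Fin k) (MultisetElt L)) :
    Matrix (Fin k) (Fin k) ℕ :=
  A.map Sigma.fst

/-- The number of `L`-Fishburn matrices (of any dimension) of size `n`: the entries are elements of
the multiset `L`, equal integers that are different elements of the multiset being
distinguished. -/
noncomputable def multisetFishburnNumber (L : ℕ → ℕ) (n : ℕ) : ℕ :=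
  Nat.card {A : Σ k : ℕ, Matrix (Fin k) (Fin k) (MultisetElt L) //
    IsFishburn (entryValues A.2) ∧ matrixSize (entryValues A.2) = n}

/-- The generating function `∑ₘ L m zᵐ` of the multiset with multiplicity function `L`. -/
noncomputable def multisetSeries (L : ℕ → ℕ) : PowerSeries ℚ :=
  PowerSeries.mk fun m => (L m : ℚ)

/-- The formal sum `∑ₖ F k` of a sequence of power series, taken coefficientwise
(each coefficient being nonzero for finitely many `k` only). -/
noncomputable def formalSum (F : ℕ → PowerSeries ℚ) : PowerSeries ℚ :=
  PowerSeries.mk fun n => ∑ᶠ k : ℕ, PowerSeries.coeff n (F k)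

/-- The formal power series `∑_{k ≥ 0} ∏_{1 ≤ j ≤ k} (1 - f ^ (-j))`, for `f` with nonzero
constant term. -/
noncomputable def fishburnSeries (f : PowerSeries ℚ) : PowerSeries ℚ :=
  formalSum fun k => ∏ j ∈ Finset.Icc 1 k, (1 - (f ^ j)⁻¹)

/-- The formal power series `∑_{k ≥ 0} ∏_{1 ≤ j ≤ k} (1 - (1 - z) ^ j)`. -/
noncomputable def zagierSeries : PowerSeries ℚ :=
  formalSum fun k => ∏ j ∈ Finset.Icc 1 k, (1 - (1 - PowerSeries.X) ^ j)

/-- The formal sums used here are legitimate: if every factor has zero constant term, then the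
`k`-th product does not contribute to the coefficient of `zⁿ` for `n < k`. -/
theorem coeff_prod_eq_zero_of_lt (g : ℕ → PowerSeries ℚ)
    (hg : ∀ j, PowerSeries.constantCoeff (g j) = 0) {n k : ℕ} (hnk : n < k) :
    PowerSeries.coeff n (∏ j ∈ Finset.Icc 1 k, g j) = 0 := by
  have h : (PowerSeries.X : PowerSeries ℚ) ^ k ∣ ∏ j ∈ Finset.Icc 1 k, g j := by
    have h' := Finset.prod_dvd_prod_of_dvd (s := Finset.Icc 1 k)
      (fun _ => (PowerSeries.X : PowerSeries ℚ)) g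
      (fun j _ => PowerSeries.X_dvd_iff.mpr (hg j))
    simpa using h'
  exact PowerSeries.X_pow_dvd_iff.mp h n hnk

theorem fishburn_factor_constantCoeff (f : PowerSeries ℚ)
    (hf : PowerSeries.constantCoeff f = 1) (j : ℕ) :
    PowerSeries.constantCoeff (1 - (f ^ j)⁻¹) = 0 := by
  simp [PowerSeries.constantCoeff_inv, hf]

theorem zagier_factor_constantCoeff (j : ℕ) :
    PowerSeries.constantCoeff (1 - (1 - PowerSeries.X : PowerSeries ℚ) ^ j) = 0 := by
  simp

/-- `a n = b n * (1 + O(1 / n))` as `n → ∞`. -/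
def AsympEq (a b : ℕ → ℝ) : Prop :=
  ∃ ε : ℕ → ℝ, (ε =O[atTop] fun n : ℕ => 1 / (n : ℝ)) ∧ ∀ᶠ n in atTop, a n = b n * (1 + ε n)

/-!
The number of `L`-Fishburn matrices of dimension `k` is computed by inclusion-exclusion over the
columns that are required to vanish; the condition on the rows is handled exactly. If `a` counts the
columns not required to vanish in the rows processed so far, from the bottom, then each new row
contributes a factor `Λ ^ a - 1`, with a sign if its column is required to vanish. Summing over all
`k`, the rows spent at level `a` form a geometric series, so that level `a` contributes
`(Λ ^ a - 1) / Λ ^ a = 1 - Λ ^ (-a)` (`X_pow_dvd_sum_levelSum_sub`,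
`multisetFishburnNumber_eq_coeff`). All formal sums are handled modulo powers of the variable.

For the asymptotics put `Λ = e ^ t`, so that the series becomes `F(t) = ∑ₖ ∏_{j ≤ k} (1 - q ^ j)`
with `q = e ^ (-t)`. The two-variable series `S(x) = (1 - x) ∑ₙ x ^ n ∏_{1 ≤ i ≤ n} (1 - x q ^ i)`
satisfies `S(x) = 1 - q x² - q² x³ S(q x)` (`tailSum_functional_equation`). For `x = q ^ M` its
coefficients are polynomials in the indeterminate `M`, the substitution `x ↦ q x` is the shift
`M ↦ M + 1`, and the equation has only one solution (`X_pow_dvd_of_shift`). Another expression for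
the solution is `ℓ (e ^ (t (6 M Y - 6 Y² + M / 2 + 1 / 24)))`, where `ℓ` is the linear functional
acting on polynomials in `Y` with `ℓ (e ^ (u Y)) = sinh (u / 6) / cosh (u / 4)`; its moments are
twisted Bernoulli numbers (`moment_generating_function`). Comparison of the terms linear in `M`
gives the formal form of Zagier's strange identity,
`F(t) = e ^ (t / 24) ∑ₘ 6 (-6) ^ m ℓ (Y ^ (2 m + 1)) t ^ m / m!`
(`X_pow_dvd_tailSum_sub_momentSeries`).

The Fourier series of the Bernoulli polynomials and the Wallis product then yield the growth of the
coefficients, `K m! (6 / π²) ^ m √m (1 + O(1 / m))` (`factorialGrowth_momentSeries`). Growth of this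
type is preserved by the factor `e ^ (t / 24)` and by the substitution `t = log Λ(z)`: since the
coefficients grow factorially, the coefficient of `z ^ n` only depends on the terms `t ^ (n - j)`
with `j` small, and the `j`-th of them contributes a fraction `x ^ j / j!` of the whole, which adds
up to a factor `e ^ x`, `x = (π² / 6) (λ₂ / λ₁² - 1 / 2)` (`FactorialGrowth.transfer`). Stirling's
formula with a rate finishes the proof.
-/

/-! ### Matrices counted by inclusion-exclusion -/

theorem matrixSize_eq_sum_prod {k : ℕ} (V : Matrix (Fin k) (Fin k) ℕ) :
    matrixSize V = ∑ p : Fin k × Fin k, V p.1 p.2 :=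
  (Fintype.sum_prod_type' fun i j => V i j).symm

/-- For matrices of a fixed dimension, the count is a sum over the value matrices. -/
theorem card_multiset_matrices (L : ℕ → ℕ) (k n : ℕ) :
    Finite {A : Matrix (Fin k) (Fin k) (MultisetElt L) //
      IsFishburn (entryValues A) ∧ matrixSize (entryValues A) = n} ∧
    (Nat.card {A : Matrix (Fin k) (Fin k) (MultisetElt L) //
      IsFishburn (entryValues A) ∧ matrixSize (entryValues A) = n}) =
    ∑ l ∈ Finset.finsuppAntidiag (Finset.univ : Finset (Fin k × Fin k)) n,
      open Classical in
      if IsFishburn (Matrix.of fun i j => l (i, j)) then ∏ p, L (l p) else 0 := by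
  classical
  let e : {A : Matrix (Fin k) (Fin k) (MultisetElt L) //
      IsFishburn (entryValues A) ∧ matrixSize (entryValues A) = n} ≃
      Σ l : {l : Fin k × Fin k →₀ ℕ // l ∈ (Finset.finsuppAntidiag Finset.univ n).filter
        (fun l => IsFishburn (Matrix.of fun i j => l (i, j)))}, ∀ p, Fin (L (l.1 p)) :=
    { toFun := fun A => ⟨⟨Finsupp.equivFunOnFinite.symm fun p => (A.1 p.1 p.2).1, by
        have h := A.2
        simp only [Finset.mem_filter, Finset.mem_finsuppAntidiag]
        exact ⟨⟨(matrixSize_eq_sum_prod _).symm.trans h.2, Finset.subset_univ _⟩, h.1⟩⟩,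
        fun p => (A.1 p.1 p.2).2⟩
      invFun := fun x => ⟨fun i j => ⟨x.1.1 (i, j), x.2 (i, j)⟩, by
        have h := x.1.2
        simp only [Finset.mem_filter, Finset.mem_finsuppAntidiag] at h
        exact ⟨h.2, (matrixSize_eq_sum_prod _).trans h.1.1⟩⟩
      left_inv := fun A => rfl
      right_inv := fun x => by
        obtain ⟨⟨l, hl⟩, f⟩ := x
        obtain ⟨g, rfl⟩ := Finsupp.equivFunOnFinite.symm.surjective l
        rfl }
  refine ⟨Finite.of_equiv _ e.symm, ?_⟩
  rw [Nat.card_congr e, Nat.card_sigma, ← Finset.sum_filter]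
  simp only [Nat.card_eq_fintype_card, Fintype.card_pi, Fintype.card_fin]
  exact Finset.sum_coe_sort ((Finset.finsuppAntidiag Finset.univ n).filter
        (fun l : Fin k × Fin k →₀ ℕ => IsFishburn (Matrix.of fun i j => l (i, j))))
    (fun l => ∏ p, L (l p))

/-- Inclusion-exclusion over the rows (`d i = false`) and columns (`e j = false`) that are
required to vanish. -/
theorem isFishburn_indicator {k : ℕ} (V : Fin k → Fin k → ℕ) :
    (open Classical in if IsFishburn (Matrix.of V) then (1 : ℚ) else 0) =
    ∑ e : Fin k → Bool, ∑ d : Fin k → Bool,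
      (∏ j, if e j then (1 : ℚ) else -1) * ((∏ i, if d i then (1 : ℚ) else -1) *
        ∏ p : Fin k × Fin k,
          if (p.1 ≤ p.2 ∧ d p.1 ∧ e p.2) ∨ V p.1 p.2 = 0 then (1 : ℚ) else 0) := by
  classical
  have hrow : ∀ d : Fin k → Bool, (∏ i, if d i ∨ ∀ j, V i j = 0 then (1 : ℚ) else 0) =
      if ∀ i, d i ∨ ∀ j, V i j = 0 then 1 else 0 := by
    intro d; simp [Finset.prod_ite_zero]
  have hcol : ∀ e : Fin k → Bool, (∏ j, if e j ∨ ∀ i, V i j = 0 then (1 : ℚ) else 0) =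
      if ∀ j, e j ∨ ∀ i, V i j = 0 then 1 else 0 := by
    intro e; simp [Finset.prod_ite_zero]
  have key : ∀ e d : Fin k → Bool,
      (∏ p : Fin k × Fin k, if (p.1 ≤ p.2 ∧ d p.1 ∧ e p.2) ∨ V p.1 p.2 = 0
        then (1 : ℚ) else 0) =
      (if (Matrix.of V).BlockTriangular id then 1 else 0) *
        ((∏ j, if e j ∨ ∀ i, V i j = 0 then (1 : ℚ) else 0) *
        ∏ i, if d i ∨ ∀ j, V i j = 0 then (1 : ℚ) else 0) := by
    intro e d
    rw [hrow, hcol, Finset.prod_ite_zero]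
    simp only [Finset.prod_const_one, ← ite_and, mul_ite, mul_one, mul_zero]
    congr 1
    apply propext
    simp only [Finset.mem_univ, true_implies, Prod.forall, Matrix.BlockTriangular, id,
      Matrix.of_apply]
    constructor
    · intro h
      refine ⟨⟨fun i => ?_, fun j => ?_⟩, fun i j hij => ?_⟩
      · by_cases hd : d i
        · exact Or.inl hd
        · exact Or.inr fun j => (h i j).resolve_left (by tauto)
      · by_cases hd : e j
        · exact Or.inl hd
        · exact Or.inr fun i => (h i j).resolve_left (by tauto)
      · exact (h i j).resolve_left (by rintro ⟨h1, -⟩; exact absurd hij (not_lt.mpr h1))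
    · rintro ⟨⟨h1, h2⟩, h3⟩ i j
      rcases le_or_gt i j with hij | hij
      · rcases h1 i with h | h
        · rcases h2 j with h' | h'
          · exact Or.inl ⟨hij, h, h'⟩
          · exact Or.inr (h' i)
        · exact Or.inr (h j)
      · exact Or.inr (h3 hij)
  -- `1 - z = ∑_b ± (b ∨ z)` for each factor of the product, multiplied out
  have expand : ∀ (z : Fin k → Prop) [DecidablePred z],
      (∑ e : Fin k → Bool, (∏ j, if e j then (1 : ℚ) else -1) *
      ∏ j, if e j ∨ z j then (1 : ℚ) else 0) = ∏ j, if z j then (0 : ℚ) else 1 := by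
    intro z _
    simp only [← Finset.prod_mul_distrib]
    have h := Finset.prod_univ_sum (fun _ : Fin k => (Finset.univ : Finset Bool))
      (fun j b => (if b then (1 : ℚ) else -1) * if b ∨ z j then (1 : ℚ) else 0)
    rw [Fintype.piFinset_univ] at h
    rw [← h]
    refine Finset.prod_congr rfl fun j _ => ?_
    by_cases hz : z j <;> simp [hz]
  calc (if IsFishburn (Matrix.of V) then (1 : ℚ) else 0)
      = (if (Matrix.of V).BlockTriangular id then 1 else 0) *
        ((∏ j, if ∀ i, V i j = 0 then (0 : ℚ) else 1) *
        ∏ i, if ∀ j, V i j = 0 then (0 : ℚ) else 1) := by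
        have h1 : ∀ (z : Fin k → Prop) [DecidablePred z], (∏ j, if z j then (0 : ℚ) else 1) =
            if ∀ j, ¬ z j then 1 else 0 := by
          intro z _
          split_ifs with h
          · exact Finset.prod_eq_one fun j _ => if_neg (h j)
          · push Not at h
            obtain ⟨j, hj⟩ := h
            exact Finset.prod_eq_zero (Finset.mem_univ j) (if_pos hj)
        rw [h1, h1]
        simp only [← ite_and, mul_ite, mul_one, mul_zero]
        congr 1
        apply propext
        unfold IsFishburn
        simp only [Matrix.of_apply, not_forall, ne_eq]
        tauto
    _ = _ := by
        rw [← expand, ← expand, Finset.sum_mul_sum, Finset.mul_sum]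
        refine Finset.sum_congr rfl fun e _ => ?_
        rw [Finset.mul_sum]
        refine Finset.sum_congr rfl fun d _ => ?_
        rw [key]
        ring

/-- The number of columns `j ≥ i` that are not required to vanish (`e j = true`); these are the
positions in row `i` that may carry a nonzero entry. -/
def freeCount {k : ℕ} (e : Fin k → Bool) (i : Fin k) : ℕ :=
  (Finset.univ.filter fun j => i ≤ j ∧ e j).card

/-- The generating function in dimension `k`. Once the set of columns required to vanish is fixed,
the rows are independent, and row `i` is an arbitrary nonzero choice of `freeCount e i` entries. -/
theorem card_eq_coeff (L : ℕ → ℕ) (hL : L 0 = 1) (k n : ℕ) :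
    ((Nat.card {A : Matrix (Fin k) (Fin k) (MultisetElt L) //
      IsFishburn (entryValues A) ∧ matrixSize (entryValues A) = n} : ℕ) : ℚ) =
    PowerSeries.coeff n (∑ e : Fin k → Bool, (∏ j, if e j then (1 : PowerSeries ℚ) else -1) *
      ∏ i, (multisetSeries L ^ freeCount e i - 1)) := by
  classical
  rw [(card_multiset_matrices L k n).2]
  have hexp : ∀ e : Fin k → Bool, ∏ i, (multisetSeries L ^ freeCount e i - 1) =
      ∑ d : Fin k → Bool, (∏ i, if d i then (1 : PowerSeries ℚ) else -1) *
        ∏ p : Fin k × Fin k, if p.1 ≤ p.2 ∧ d p.1 ∧ e p.2 then multisetSeries L else 1 := by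
    intro e
    have h := Finset.prod_univ_sum (fun _ : Fin k => (Finset.univ : Finset Bool))
      (fun i b => (if b then (1 : PowerSeries ℚ) else -1) *
        ∏ j, if i ≤ j ∧ b ∧ e j then multisetSeries L else 1)
    rw [Fintype.piFinset_univ] at h
    convert! h using 1
    · refine Finset.prod_congr rfl fun i _ => ?_
      simp [freeCount, Finset.prod_ite, sub_eq_add_neg]
    · refine Finset.sum_congr rfl fun d _ => ?_
      rw [Finset.prod_mul_distrib, ← Finset.univ_product_univ, Finset.prod_product]
  have hsgn : ∀ e : Fin k → Bool, (∏ j, if e j then (1 : PowerSeries ℚ) else -1) =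
      PowerSeries.C (∏ j, if e j then (1 : ℚ) else -1) := by
    intro e
    rw [map_prod]
    refine Finset.prod_congr rfl fun j _ => ?_
    split_ifs <;> simp
  simp only [hexp, hsgn, map_sum, Finset.mul_sum, PowerSeries.coeff_C_mul, PowerSeries.coeff_prod]
  have : ∀ l : Fin k × Fin k →₀ ℕ, (((if IsFishburn (Matrix.of fun i j => l (i, j)) then
      ∏ p, L (l p) else 0 : ℕ)) : ℚ) = ∑ e : Fin k → Bool, ∑ d : Fin k → Bool,
      (∏ j, if e j then (1 : ℚ) else -1) * ((∏ i, if d i then (1 : ℚ) else -1) *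
        ∏ p : Fin k × Fin k, PowerSeries.coeff (l p)
          (if p.1 ≤ p.2 ∧ d p.1 ∧ e p.2 then multisetSeries L else 1)) := by
    intro l
    have h := isFishburn_indicator (fun i j => l (i, j))
    have h' : (((if IsFishburn (Matrix.of fun i j => l (i, j)) then ∏ p, L (l p) else 0 : ℕ)) : ℚ) =
      (if IsFishburn (Matrix.of fun i j => l (i, j)) then (1 : ℚ) else 0) * ∏ p, (L (l p) : ℚ) := by
      split_ifs <;> simp
    rw [h', h, Finset.sum_mul]
    refine Finset.sum_congr rfl fun e _ => ?_
    rw [Finset.sum_mul]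
    refine Finset.sum_congr rfl fun d _ => ?_
    rw [mul_assoc, mul_assoc, ← Finset.prod_mul_distrib]
    congr 2
    refine Finset.prod_congr rfl fun p _ => ?_
    by_cases hp : p.1 ≤ p.2 ∧ d p.1 ∧ e p.2
    · simp [hp, multisetSeries]
    · by_cases h0 : l p = 0
      · simp [hp, h0, hL]
      · simp [hp, h0, PowerSeries.coeff_one]
  push_cast [Nat.cast_sum]
  simp only [Nat.cast_ite, Nat.cast_prod, Nat.cast_zero] at this
  simp only [this]
  rw [Finset.sum_comm]
  refine Finset.sum_congr rfl fun e _ => ?_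
  rw [Finset.sum_comm]

/-! ### The generating function -/

theorem freeCount_cons_zero {k : ℕ} (b : Bool) (e : Fin k → Bool) :
    freeCount (Fin.cons b e : Fin (k + 1) → Bool) 0 =
      (if b then 1 else 0) + (Finset.univ.filter fun j => e j).card := by
  unfold freeCount
  rw [Fin.card_filter_univ_succ']
  cases b <;> simp

theorem freeCount_cons_succ {k : ℕ} (b : Bool) (e : Fin k → Bool) (i : Fin k) :
    freeCount (Fin.cons b e : Fin (k + 1) → Bool) i.succ = freeCount e i := by
  unfold freeCount
  rw [Fin.card_filter_univ_succ']
  simp [Fin.succ_le_succ_iff]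

/-- The part of the inclusion-exclusion sum for dimension `k` in which exactly `a` columns are not
required to vanish. -/
noncomputable def levelSum (f : PowerSeries ℚ) (k a : ℕ) : PowerSeries ℚ :=
  ∑ e : Fin k → Bool, if (Finset.univ.filter fun j => e j).card = a then
    (∏ j, if e j then (1 : PowerSeries ℚ) else -1) * ∏ i, (f ^ freeCount e i - 1) else 0

theorem levelSum_zero (f : PowerSeries ℚ) (a : ℕ) : levelSum f 0 a = if a = 0 then 1 else 0 := by
  rcases eq_or_ne a 0 with rfl | h
  · simp [levelSum]
  · simp [levelSum, h, h.symm]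

theorem sum_bool_cons {M : Type*} [AddCommMonoid M] {k : ℕ} (F : (Fin (k + 1) → Bool) → M) :
    ∑ e, F e = (∑ e : Fin k → Bool, F (Fin.cons true e)) + ∑ e : Fin k → Bool,
      F (Fin.cons false e) := by
  rw [← (Fin.consEquiv fun _ : Fin (k + 1) => Bool).sum_comp, Fintype.sum_prod_type]
  simp [Fin.consEquiv]

theorem levelSum_succ_zero (f : PowerSeries ℚ) (k : ℕ) : levelSum f (k + 1) 0 = 0 := by
  refine Finset.sum_eq_zero fun e _ => ?_
  split_ifs with h
  · rw [Fin.prod_univ_succ (fun i => f ^ freeCount e i - 1)]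
    have : freeCount e 0 = 0 := by simpa [freeCount] using h
    simp [this]
  · rfl

/-- Adding a new first row and column: the column is either free, which raises the level, or
required to vanish, which contributes a sign. -/
theorem levelSum_succ_succ (f : PowerSeries ℚ) (k a : ℕ) :
    levelSum f (k + 1) (a + 1) =
      (f ^ (a + 1) - 1) * (levelSum f k a - levelSum f k (a + 1)) := by
  unfold levelSum
  rw [sum_bool_cons, mul_sub, Finset.mul_sum, Finset.mul_sum, sub_eq_add_neg,
    ← Finset.sum_neg_distrib]
  congr 1
  · refine Finset.sum_congr rfl fun e _ => ?_
    simp only [Fin.prod_univ_succ, freeCount_cons_zero, freeCount_cons_succ,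
      Fin.card_filter_univ_succ', Fin.cons_zero, Fin.cons_succ]
    simp only [if_true, add_comm 1, add_left_inj]
    split_ifs with h
    · rw [h]; ring
    · simp
  · refine Finset.sum_congr rfl fun e _ => ?_
    simp only [Fin.prod_univ_succ, freeCount_cons_zero, freeCount_cons_succ,
      Fin.card_filter_univ_succ', Fin.cons_zero, Fin.cons_succ]
    simp only [Bool.false_eq_true, if_false, zero_add]
    split_ifs with h
    · rw [h]; ring
    · simp

theorem sum_levelSum (f : PowerSeries ℚ) {k N : ℕ} (hk : k < N) :
    ∑ a ∈ Finset.range N, levelSum f k a = ∑ e : Fin k → Bool,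
      (∏ j, if e j then (1 : PowerSeries ℚ) else -1) * ∏ i, (f ^ freeCount e i - 1) := by
  unfold levelSum
  rw [Finset.sum_comm]
  refine Finset.sum_congr rfl fun e _ => ?_
  have := Finset.card_filter_le (Finset.univ : Finset (Fin k)) fun j => e j = true
  simp only [Finset.card_univ, Fintype.card_fin] at this
  rw [Finset.sum_ite_eq, if_pos]
  simp only [Finset.mem_range]
  omega

theorem X_dvd_pow_sub_one {f : PowerSeries ℚ} (hf : PowerSeries.constantCoeff f = 1) (j : ℕ) :
    PowerSeries.X ∣ f ^ j - 1 := by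
  rw [PowerSeries.X_dvd_iff]; simp [hf]

theorem X_pow_dvd_inclusion_exclusion {f : PowerSeries ℚ} (hf : PowerSeries.constantCoeff f = 1)
    (k : ℕ) : (PowerSeries.X : PowerSeries ℚ) ^ k ∣ ∑ e : Fin k → Bool,
      (∏ j, if e j then (1 : PowerSeries ℚ) else -1) * ∏ i, (f ^ freeCount e i - 1) := by
  refine Finset.dvd_sum fun e _ => dvd_mul_of_dvd_right ?_ _
  have := Finset.prod_dvd_prod_of_dvd (s := (Finset.univ : Finset (Fin k)))
    (fun _ => (PowerSeries.X : PowerSeries ℚ)) (fun i => f ^ freeCount e i - 1)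
    (fun i _ => X_dvd_pow_sub_one hf _)
  simpa using this

theorem X_pow_dvd_levelSum {f : PowerSeries ℚ} (hf : PowerSeries.constantCoeff f = 1)
    (k a : ℕ) : (PowerSeries.X : PowerSeries ℚ) ^ k ∣ levelSum f k a := by
  refine Finset.dvd_sum fun e _ => ?_
  split_ifs
  · refine dvd_mul_of_dvd_right ?_ _
    have := Finset.prod_dvd_prod_of_dvd (s := (Finset.univ : Finset (Fin k)))
      (fun _ => (PowerSeries.X : PowerSeries ℚ)) (fun i => f ^ freeCount e i - 1)
      (fun i _ => X_dvd_pow_sub_one hf _)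
    simpa using this
  · exact dvd_zero _

/-- Summed over all dimensions, level `a` contributes `∏_{1 ≤ j ≤ a} (1 - f ^ (-j))`. -/
theorem X_pow_dvd_sum_levelSum_sub {f : PowerSeries ℚ} (hf : PowerSeries.constantCoeff f = 1)
    (N a : ℕ) : (PowerSeries.X : PowerSeries ℚ) ^ N ∣
      ∑ k ∈ Finset.range N, levelSum f k a - ∏ j ∈ Finset.Icc 1 a, (1 - (f ^ j)⁻¹) := by
  induction a with
  | zero =>
    cases N with
    | zero => simp
    | succ N => simp [Finset.sum_range_succ', levelSum_succ_zero, levelSum_zero]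
  | succ a ih =>
    set V : ℕ → PowerSeries ℚ := fun a => ∑ k ∈ Finset.range N, levelSum f k a with hV
    set P : ℕ → PowerSeries ℚ := fun a => ∏ j ∈ Finset.Icc 1 a, (1 - (f ^ j)⁻¹) with hP
    change _ ∣ V (a + 1) - P (a + 1)
    change _ ∣ V a - P a at ih
    -- the sum of the recursion over `k < N`, completed by the term of dimension `N`
    have h1 : V (a + 1) + levelSum f N (a + 1) = (f ^ (a + 1) - 1) * (V a - V (a + 1)) := by
      have : ∑ k ∈ Finset.range (N + 1), levelSum f k (a + 1) =
          (f ^ (a + 1) - 1) * (V a - V (a + 1)) := by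
        rw [Finset.sum_range_succ', levelSum_zero, if_neg (Nat.succ_ne_zero a), add_zero]
        simp only [levelSum_succ_succ, ← Finset.mul_sum, Finset.sum_sub_distrib, hV]
      rw [← this, Finset.sum_range_succ]
    have hc : PowerSeries.constantCoeff (f ^ (a + 1)) ≠ 0 := by simp [hf]
    have h2 : f ^ (a + 1) * P (a + 1) = (f ^ (a + 1) - 1) * P a := by
      have h3 : P (a + 1) = P a * (1 - (f ^ (a + 1))⁻¹) := by
        simp only [hP]; rw [Finset.prod_Icc_succ_top (by omega)]
      rw [h3]
      linear_combination (- P a) * PowerSeries.mul_inv_cancel (f ^ (a + 1)) hc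
    have h4 : V (a + 1) - P (a + 1) = (f ^ (a + 1))⁻¹ *
        ((f ^ (a + 1) - 1) * (V a - P a) - levelSum f N (a + 1)) := by
      linear_combination (-(V (a + 1) - P (a + 1))) * PowerSeries.inv_mul_cancel (f ^ (a + 1)) hc +
        (f ^ (a + 1))⁻¹ * (h1 - h2)
    rw [h4]
    exact dvd_mul_of_dvd_right (dvd_sub (dvd_mul_of_dvd_right ih _) (X_pow_dvd_levelSum hf _ _)) _

theorem coeff_fishburnSeries {f : PowerSeries ℚ} (hf : PowerSeries.constantCoeff f = 1)
    {n N : ℕ} (hN : n < N) : PowerSeries.coeff n (fishburnSeries f) = PowerSeries.coeff n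
      (∑ a ∈ Finset.range N, ∏ j ∈ Finset.Icc 1 a, (1 - (f ^ j)⁻¹)) := by
  rw [fishburnSeries, formalSum, PowerSeries.coeff_mk, map_sum]
  refine finsum_eq_sum_of_support_subset _ fun k hk => ?_
  by_contra hk'
  refine hk (coeff_prod_eq_zero_of_lt _ (fishburn_factor_constantCoeff f hf) ?_)
  simp only [Finset.coe_range, Set.mem_Iio] at hk'
  omega

theorem constantCoeff_multisetSeries {L : ℕ → ℕ} (hL : L 0 = 1) :
    PowerSeries.constantCoeff (multisetSeries L) = 1 := by
  rw [← PowerSeries.coeff_zero_eq_constantCoeff_apply]; simp [multisetSeries, hL]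

/-- The multiset Fishburn numbers are the coefficients of the Fishburn series. -/
theorem multisetFishburnNumber_eq_coeff (L : ℕ → ℕ) (hL : L 0 = 1) (n : ℕ) :
    (multisetFishburnNumber L n : ℚ) =
      PowerSeries.coeff n (fishburnSeries (multisetSeries L)) := by
  have hf := constantCoeff_multisetSeries hL
  set f := multisetSeries L with hfdef
  let T : ℕ → Type := fun k => {A : Matrix (Fin k) (Fin k) (MultisetElt L) //
      IsFishburn (entryValues A) ∧ matrixSize (entryValues A) = n}
  have hfin : ∀ k, Finite (T k) := fun k => (card_multiset_matrices L k n).1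
  -- no row vanishes, so that the dimension is at most the size
  have hempty : ∀ k, n < k → IsEmpty (T k) := by
    intro k hk
    have h : ((Nat.card (T k) : ℕ) : ℚ) = 0 := by
      rw [card_eq_coeff L hL k n]
      exact PowerSeries.X_pow_dvd_iff.mp (X_pow_dvd_inclusion_exclusion hf k) n hk
    exact (Nat.card_eq_zero.mp (by exact_mod_cast h)).resolve_right
      (not_infinite_iff_finite.mpr (hfin k))
  let e : {A : Σ k : ℕ, Matrix (Fin k) (Fin k) (MultisetElt L) //
      IsFishburn (entryValues A.2) ∧ matrixSize (entryValues A.2) = n} ≃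
      Σ k : Fin (n + 1), T k :=
    { toFun := fun A => ⟨⟨A.1.1, by
        by_contra hk
        exact (hempty A.1.1 (by omega)).false ⟨A.1.2, A.2⟩⟩, ⟨A.1.2, A.2⟩⟩
      invFun := fun x => ⟨⟨x.1, x.2.1⟩, x.2.2⟩
      left_inv := fun A => rfl
      right_inv := fun x => rfl }
  rw [multisetFishburnNumber, Nat.card_congr e, Nat.card_sigma, Nat.cast_sum,
    Fin.sum_univ_eq_sum_range (fun k => ((Nat.card (T k) : ℕ) : ℚ)) (n + 1)]
  simp only [T, card_eq_coeff L hL]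
  rw [coeff_fishburnSeries hf (Nat.lt_succ_self n), ← map_sum, ← sub_eq_zero, ← map_sub]
  refine PowerSeries.X_pow_dvd_iff.mp ?_ n (Nat.lt_succ_self n)
  have h1 : ∑ k ∈ Finset.range (n + 1), ∑ e : Fin k → Bool,
      (∏ j, if e j then (1 : PowerSeries ℚ) else -1) * ∏ i, (f ^ freeCount e i - 1) =
      ∑ a ∈ Finset.range (n + 1), ∑ k ∈ Finset.range (n + 1), levelSum f k a := by
    rw [Finset.sum_comm]
    exact Finset.sum_congr rfl fun k hk => (sum_levelSum f (Finset.mem_range.mp hk)).symm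
  rw [h1, ← Finset.sum_sub_distrib]
  exact Finset.dvd_sum fun a _ => X_pow_dvd_sum_levelSum_sub hf _ _

theorem mk_one_inv : (multisetSeries fun _ => 1)⁻¹ = 1 - PowerSeries.X := by
  have h : multisetSeries (fun _ => 1) = PowerSeries.mk 1 := by
    ext; simp [multisetSeries]
  rw [h, PowerSeries.inv_eq_iff_mul_eq_one, mul_comm, PowerSeries.mk_one_mul_one_sub_eq_one]
  rw [← PowerSeries.coeff_zero_eq_constantCoeff_apply]; simp

theorem fishburnSeries_one : fishburnSeries (multisetSeries fun _ => 1) = zagierSeries := by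
  unfold fishburnSeries zagierSeries
  congr 1
  funext k
  refine Finset.prod_congr rfl fun j _ => ?_
  rw [← mk_one_inv]
  congr 1
  rw [PowerSeries.inv_eq_iff_mul_eq_one, ← mul_pow, PowerSeries.inv_mul_cancel, one_pow]
  · rw [constantCoeff_multisetSeries rfl]; exact one_ne_zero
  · rw [map_pow, constantCoeff_multisetSeries rfl]; simp

theorem fishburnNumber_eq (n : ℕ) : fishburnNumber n = multisetFishburnNumber (fun _ => 1) n := by
  refine Nat.card_congr
    { toFun := fun A => ⟨⟨A.1.1, fun i j => ⟨A.1.2 i j, 0⟩⟩, A.2⟩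
      invFun := fun A => ⟨⟨A.1.1, entryValues A.1.2⟩, A.2⟩
      left_inv := fun A => rfl
      right_inv := fun A => ?_ }
  obtain ⟨⟨k, A⟩, hA⟩ := A
  refine Subtype.ext (Sigma.ext rfl (heq_of_eq ?_))
  funext i j
  exact Sigma.ext rfl (heq_of_eq (Subsingleton.elim _ _))

/-! ### Exponential series with a parameter -/

section ExpSeries

variable {A : Type*} [CommRing A] [Algebra ℚ A]

/-- The formal power series `e ^ (a t)` in the variable `t`. -/
noncomputable def expMul (a : A) : PowerSeries A := PowerSeries.rescale a (PowerSeries.exp A)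

theorem coeff_expMul (a : A) (n : ℕ) :
    PowerSeries.coeff n (expMul a) = a ^ n * algebraMap ℚ A (1 / n.factorial) := by
  simp [expMul, PowerSeries.coeff_rescale, PowerSeries.coeff_exp]

theorem expMul_add (a b : A) : expMul (a + b) = expMul a * expMul b :=
  (PowerSeries.exp_mul_exp_eq_exp_add a b).symm

theorem expMul_zero : expMul (0 : A) = 1 := by
  simp [expMul, PowerSeries.constantCoeff_exp]

theorem expMul_nsmul (a : A) (n : ℕ) : expMul (n * a) = expMul a ^ n := by
  induction n with
  | zero => simp [expMul_zero]
  | succ n ih => rw [pow_succ, ← ih, ← expMul_add]; congr 1; push_cast; ring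

theorem constantCoeff_expMul (a : A) : PowerSeries.constantCoeff (expMul a) = 1 := by
  rw [← PowerSeries.coeff_zero_eq_constantCoeff_apply, coeff_expMul]; simp

theorem map_expMul {B : Type*} [CommRing B] [Algebra ℚ B] (φ : A →+* B) (a : A) :
    PowerSeries.map φ (expMul a) = expMul (φ a) := by
  ext n
  simp [coeff_expMul, RingHom.map_rat_algebraMap]

end ExpSeries

/-! ### The functional equation -/

section FunctionalEquation

/-- The partial sums `∑_{n < N} x ^ n ∏_{1 ≤ i ≤ n} (1 - x q ^ i)`. -/
def tailSum {A : Type*} [CommRing A] (x q : A) (N : ℕ) : A :=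
  ∑ n ∈ Finset.range N, (∏ i ∈ Finset.range n, (1 - x * q ^ (i + 1))) * x ^ n

/-- The functional equation `S(x) + q² x³ S(q x) = 1 - q x²` of the series
`S(x) = (1 - x) ∑ₙ x ^ n ∏_{1 ≤ i ≤ n} (1 - x q ^ i)`, for partial sums. -/
theorem tailSum_functional_equation {A : Type*} [CommRing A] (x q : A) (N : ℕ) :
    (1 - x) * tailSum x q N + q ^ 2 * x ^ 3 * ((1 - x * q) * tailSum (x * q) q N) =
      1 - q * x ^ 2 + (∏ i ∈ Finset.range N, (1 - x * q ^ (i + 1))) *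
        (x ^ (N + 1) - x ^ N - (1 - x * q ^ (N + 1)) * x ^ (N + 1)) := by
  have hQ : ∀ n, (1 - x * q) * ∏ i ∈ Finset.range n, (1 - x * q * q ^ (i + 1)) =
      ∏ i ∈ Finset.range (n + 1), (1 - x * q ^ (i + 1)) := by
    intro n
    rw [Finset.prod_range_succ', mul_comm]
    simp only [zero_add, pow_one]
    congr 1
    exact Finset.prod_congr rfl fun i _ => by ring
  induction N with
  | zero => simp [tailSum]; ring
  | succ N ih =>
    have h1 := hQ N
    simp only [tailSum, Finset.sum_range_succ] at ih ⊢
    rw [Finset.prod_range_succ] at h1 ⊢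
    rw [mul_pow x q N]
    linear_combination ih + q ^ 2 * x ^ 3 * x ^ N * q ^ N * h1

/-- Uniqueness for the functional equation, modulo `t ^ N`: the lowest coefficient `d` of a solution
`D` of the homogeneous equation is a polynomial with `d (M + 1) = - d (M)`, hence zero, as the two
sides have leading coefficients of opposite sign. -/
theorem X_pow_dvd_of_shift {D u : PowerSeries (Polynomial ℚ)} {N : ℕ}
    (hu : PowerSeries.constantCoeff u = 1)
    (h : PowerSeries.X ^ N ∣ D + u * PowerSeries.map
      (Polynomial.compRingHom (Polynomial.X + 1)) D) :
    PowerSeries.X ^ N ∣ D := by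
  rw [PowerSeries.X_pow_dvd_iff] at h ⊢
  intro m
  induction m using Nat.strong_induction_on with
  | _ m ih =>
  intro hm
  have h1 := h m hm
  rw [map_add, PowerSeries.coeff_mul, Finset.sum_eq_single (0, m)] at h1
  · rw [PowerSeries.coeff_zero_eq_constantCoeff_apply, hu, one_mul, PowerSeries.coeff_map] at h1
    set d := PowerSeries.coeff m D
    simp only [Polynomial.coe_compRingHom_apply] at h1
    have h2 : (d.comp (Polynomial.X + 1)).leadingCoeff = d.leadingCoeff := by
      rw [← Polynomial.C_1,
        Polynomial.leadingCoeff_comp (by rw [Polynomial.natDegree_X_add_C]; simp), Polynomial.leadingCoeff_X_add_C, one_pow, mul_one]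
    rw [eq_neg_of_add_eq_zero_right h1, Polynomial.leadingCoeff_neg] at h2
    exact Polynomial.leadingCoeff_eq_zero.mp (by linarith)
  · rintro ⟨i, j⟩ hij hne
    simp only [Finset.HasAntidiagonal.mem_antidiagonal] at hij
    have hj : j < m := by
      rcases Nat.lt_or_ge j m with hj | hj
      · exact hj
      · exact absurd (by ext <;> simp <;> omega) hne
    simp [PowerSeries.coeff_map, ih j hj (hj.trans hm)]
  · simp

end FunctionalEquation

/-! ### Umbral calculus -/

section Umbral

variable {A : Type*} [CommRing A] [Algebra ℚ A]

/-- The linear functional on polynomials sending `Y ^ i` to the moment `h i`. -/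
noncomputable def umbral (h : ℕ → ℚ) : Polynomial A →ₗ[A] A :=
  Polynomial.lsum fun i => LinearMap.toSpanSingleton A A (algebraMap ℚ A (h i))

theorem umbral_monomial (h : ℕ → ℚ) (r : A) (i : ℕ) :
    umbral h (Polynomial.C r * Polynomial.X ^ i) = r * algebraMap ℚ A (h i) := by
  simp [umbral, Polynomial.C_mul_X_pow_eq_monomial, Polynomial.lsum_apply]

theorem umbral_C_mul (h : ℕ → ℚ) (r : A) (p : Polynomial A) :
    umbral h (Polynomial.C r * p) = r * umbral h p := by
  rw [← Polynomial.smul_eq_C_mul, map_smul, smul_eq_mul]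

theorem map_umbral (h : ℕ → ℚ) {B : Type*} [CommRing B] [Algebra ℚ B] (φ : A →+* B)
    (p : Polynomial A) : φ (umbral h p) = umbral h (p.map φ) := by
  induction p using Polynomial.induction_on' with
  | add p q hp hq => simp [hp, hq]
  | monomial n a =>
    rw [← Polynomial.C_mul_X_pow_eq_monomial, Polynomial.map_mul, Polynomial.map_pow,
      Polynomial.map_C, Polynomial.map_X, umbral_monomial, umbral_monomial]
    simp [RingHom.map_rat_algebraMap]

/-- Shifting the argument of the umbral functional multiplies the exponential generating function
of its moments by an exponential. -/
theorem umbral_add_pow (h : ℕ → ℚ) (c : ℚ) (n : ℕ) :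
    umbral h ((Polynomial.X + Polynomial.C (algebraMap ℚ A c)) ^ n) =
      algebraMap ℚ A (n.factorial * PowerSeries.coeff n
        (PowerSeries.mk (fun i => h i / i.factorial) * expMul c)) := by
  rw [(Commute.all _ _).add_pow', map_sum, PowerSeries.coeff_mul, Finset.mul_sum, map_sum]
  refine Finset.sum_congr rfl fun ij hij => ?_
  rw [Finset.HasAntidiagonal.mem_antidiagonal] at hij
  rw [map_nsmul, ← Polynomial.C_pow, mul_comm, umbral_monomial, coeff_expMul, PowerSeries.coeff_mk,
    nsmul_eq_mul, ← map_pow, ← map_mul, ← map_natCast (algebraMap ℚ A), ← map_mul]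
  congr 1
  have h1 := Nat.choose_mul_factorial_mul_factorial (Nat.le_add_right ij.1 ij.2)
  rw [Nat.add_sub_cancel_left] at h1
  have h2 := Nat.factorial_pos ij.1
  have h3 := Nat.factorial_pos ij.2
  rw [← hij, ← h1]
  push_cast
  field_simp

/-- The difference equation of the umbral functional whose moments have the exponential generating
function `sinh (u / 6) / cosh (u / 4)`. -/
theorem umbral_shift {h : ℕ → ℚ} (hh : PowerSeries.mk (fun i => h i / i.factorial) *
      (expMul (1 / 4 : ℚ) + expMul (-1 / 4 : ℚ)) = expMul (1 / 6 : ℚ) - expMul (-1 / 6 : ℚ))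
    (p : Polynomial A) :
    umbral h (p.comp (Polynomial.X + Polynomial.C (algebraMap ℚ A (1 / 4)))) +
      umbral h (p.comp (Polynomial.X + Polynomial.C (algebraMap ℚ A (-1 / 4)))) =
      p.eval (algebraMap ℚ A (1 / 6)) - p.eval (algebraMap ℚ A (-1 / 6)) := by
  induction p using Polynomial.induction_on' with
  | add p q hp hq =>
    simp only [Polynomial.add_comp, map_add, Polynomial.eval_add]
    linear_combination hp + hq
  | monomial n a =>
    rw [← Polynomial.C_mul_X_pow_eq_monomial]
    simp only [Polynomial.mul_comp, Polynomial.C_comp, Polynomial.X_pow_comp, umbral_C_mul,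
      umbral_add_pow, Polynomial.eval_mul, Polynomial.eval_C, Polynomial.eval_pow,
      Polynomial.eval_X]
    rw [← mul_add, ← mul_sub, ← map_add, ← mul_add, ← map_add, ← mul_add, hh, map_sub,
      coeff_expMul, coeff_expMul, ← map_pow, ← map_pow, ← map_sub]
    congr 2
    have := Nat.factorial_pos n
    simp only [Algebra.algebraMap_self, RingHom.id_apply]
    field_simp

/-- The umbral functional, applied coefficientwise. -/
noncomputable def umbralSeries (h : ℕ → ℚ) (G : PowerSeries (Polynomial A)) : PowerSeries A :=
  PowerSeries.mk fun n => umbral h (PowerSeries.coeff n G)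

theorem umbralSeries_map_C_mul (h : ℕ → ℚ) (g : PowerSeries A) (G : PowerSeries (Polynomial A)) :
    umbralSeries h (PowerSeries.map Polynomial.C g * G) = g * umbralSeries h G := by
  ext n
  simp [umbralSeries, PowerSeries.coeff_mul, umbral_C_mul]

theorem map_umbralSeries (h : ℕ → ℚ) {B : Type*} [CommRing B] [Algebra ℚ B] (φ : A →+* B)
    (G : PowerSeries (Polynomial A)) :
    PowerSeries.map φ (umbralSeries h G) =
      umbralSeries h (PowerSeries.map (Polynomial.mapRingHom φ) G) := by
  ext n; simp [umbralSeries, map_umbral]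

theorem umbralSeries_shift {h : ℕ → ℚ} (hh : PowerSeries.mk (fun i => h i / i.factorial) *
      (expMul (1 / 4 : ℚ) + expMul (-1 / 4 : ℚ)) = expMul (1 / 6 : ℚ) - expMul (-1 / 6 : ℚ))
    (p : Polynomial A) :
    umbralSeries h (expMul (p.comp (Polynomial.X + Polynomial.C (algebraMap ℚ A (1 / 4))))) +
      umbralSeries h (expMul (p.comp (Polynomial.X + Polynomial.C (algebraMap ℚ A (-1 / 4))))) =
      expMul (p.eval (algebraMap ℚ A (1 / 6))) - expMul (p.eval (algebraMap ℚ A (-1 / 6))) := by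
  ext n
  have := umbral_shift hh (p ^ n)
  simp only [Polynomial.pow_comp, Polynomial.eval_pow] at this
  simp only [umbralSeries, map_add, map_sub, PowerSeries.coeff_mk, coeff_expMul]
  rw [IsScalarTower.algebraMap_apply ℚ A (Polynomial A), Polynomial.algebraMap_eq,
    mul_comm _ (Polynomial.C _), umbral_C_mul, mul_comm _ (Polynomial.C _), umbral_C_mul]
  linear_combination (algebraMap ℚ A (1 / n.factorial)) * this

end Umbral

/-! ### The moment functional -/

/-- The combination `∑ₐ χ₁₂(a) Bₖ(a / 12)` of values of the `k`-th Bernoulli polynomial, where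
`χ₁₂` is the even primitive character modulo `12`. -/
noncomputable def bernoulliTwist (k : ℕ) : ℚ :=
  (Polynomial.bernoulli k).eval (1 / 12) + (Polynomial.bernoulli k).eval (11 / 12) -
    (Polynomial.bernoulli k).eval (5 / 12) - (Polynomial.bernoulli k).eval (7 / 12)

/-- The moments of the linear functional that linearizes the Fishburn series: the coefficients of
the exponential generating function `sinh (u / 6) / cosh (u / 4)`. -/
noncomputable def moment (i : ℕ) : ℚ := bernoulliTwist (i + 1) / (i + 1)

/-- With `a = e ^ (u / 12)` the generating function of the Bernoulli polynomials gives
`(a - a⁵ - a⁷ + a¹¹) / (a¹² - 1) = (a⁵ - a) / (a⁶ + 1) = sinh (u / 6) / cosh (u / 4)`. -/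
theorem moment_generating_function : PowerSeries.mk (fun i => moment i / i.factorial) *
      (expMul (1 / 4 : ℚ) + expMul (-1 / 4 : ℚ)) = expMul (1 / 6 : ℚ) - expMul (-1 / 6 : ℚ) := by
  set H : PowerSeries ℚ := PowerSeries.mk (fun i => moment i / i.factorial) with hH
  set a := expMul (1 / 12 : ℚ) with ha
  set b := expMul (-1 / 12 : ℚ) with hb
  have hab : a * b = 1 := by rw [ha, hb, ← expMul_add, ← expMul_zero]; norm_num
  have hpow : ∀ (n : ℕ) (r : ℚ), r = n * (1 / 12) → expMul r = a ^ n := by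
    intro n r hr; rw [hr, expMul_nsmul]
  have hpow' : ∀ (n : ℕ) (r : ℚ), r = n * (-1 / 12) → expMul r = b ^ n := by
    intro n r hr; rw [hr, expMul_nsmul]
  have hexp : PowerSeries.exp ℚ = a ^ 12 := by
    rw [← hpow 12 1 (by norm_num)]; simp [expMul]
  have hgen : ∀ t : ℚ, PowerSeries.mk (fun k => (Polynomial.bernoulli k).eval t / k.factorial) *
      (a ^ 12 - 1) = PowerSeries.X * expMul t := by
    intro t
    have h := Polynomial.bernoulli_generating_function t
    rw [expMul, ← hexp, ← h]
    congr 2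
    funext k
    simp [div_eq_inv_mul, Polynomial.aeval_def, Polynomial.eval₂_eq_eval_map]
  have hsum : PowerSeries.mk (fun k => bernoulliTwist k / k.factorial) * (a ^ 12 - 1) =
      PowerSeries.X * (a + a ^ 11 - a ^ 5 - a ^ 7) := by
    have h1 := hgen (1 / 12)
    have h11 := hgen (11 / 12)
    have h5 := hgen (5 / 12)
    have h7 := hgen (7 / 12)
    rw [hpow 11 (11 / 12) (by norm_num)] at h11
    rw [hpow 5 (5 / 12) (by norm_num)] at h5
    rw [hpow 7 (7 / 12) (by norm_num)] at h7
    rw [← ha] at h1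
    have : PowerSeries.mk (fun k => bernoulliTwist k / k.factorial) =
      PowerSeries.mk (fun k => (Polynomial.bernoulli k).eval (1 / 12) / (k.factorial : ℚ)) +
      PowerSeries.mk (fun k => (Polynomial.bernoulli k).eval (11 / 12) / (k.factorial : ℚ)) -
      PowerSeries.mk (fun k => (Polynomial.bernoulli k).eval (5 / 12) / (k.factorial : ℚ)) -
      PowerSeries.mk (fun k => (Polynomial.bernoulli k).eval (7 / 12) / (k.factorial : ℚ)) := by
      ext k
      simp only [PowerSeries.coeff_mk, map_add, map_sub, bernoulliTwist]
      ring
    rw [this]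
    linear_combination h1 + h11 - h5 - h7
  have hX : PowerSeries.mk (fun k => bernoulliTwist k / k.factorial) = PowerSeries.X * H := by
    ext k
    cases k with
    | zero => simp [bernoulliTwist]
    | succ k =>
      rw [PowerSeries.coeff_succ_X_mul, hH, PowerSeries.coeff_mk, PowerSeries.coeff_mk, moment,
        Nat.factorial_succ]
      push_cast
      field_simp
  rw [hX, mul_assoc] at hsum
  have hsum' := mul_left_cancel₀ PowerSeries.X_ne_zero hsum
  have hne : a ^ 6 - 1 ≠ 0 := by
    intro h
    have := congrArg (PowerSeries.coeff 1) h
    rw [← hpow 6 (1 / 2) (by norm_num), map_sub, coeff_expMul] at this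
    simp [PowerSeries.coeff_one] at this
  have hmain : H * (a ^ 6 + 1) = a ^ 5 - a := by
    apply mul_left_cancel₀ hne
    linear_combination hsum'
  rw [hpow 3 (1 / 4) (by norm_num), hpow' 3 (-1 / 4) (by norm_num),
    hpow 2 (1 / 6) (by norm_num), hpow' 2 (-1 / 6) (by norm_num)]
  have hab3 : a ^ 3 * b ^ 3 = 1 := by rw [← mul_pow, hab, one_pow]
  have hab1 : a ^ 2 * b ^ 2 = 1 := by rw [← mul_pow, hab, one_pow]
  linear_combination b ^ 3 * hmain + (a ^ 2 - H * a ^ 3) * hab3 - b ^ 2 * hab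

section Linearization

open Polynomial in
/-- The exponent `6 M Y - 6 Y² + M / 2 + 1 / 24`, a polynomial in `Y` over `ℚ[M]`. -/
noncomputable def umbralExponent : ℚ[X][X] :=
  6 * C X * X - 6 * X ^ 2 + C (C (1 / 2) * X + C (1 / 24))

open Polynomial in
/-- The umbral series solves the functional equation of `S`, with `q = e ^ (-t)` and
`x = e ^ (-M t)`: completing the square in `Y` turns the shift in `M` into a shift in `Y`. -/
theorem umbralSeries_functional_equation :
    umbralSeries moment (expMul umbralExponent) + expMul (-1 : ℚ[X]) ^ 2 * expMul (-X : ℚ[X]) ^ 3 *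
      PowerSeries.map (Polynomial.compRingHom (X + 1))
        (umbralSeries moment (expMul umbralExponent)) =
      1 - expMul (-1 : ℚ[X]) * expMul (-X : ℚ[X]) ^ 2 := by
  rw [map_umbralSeries, map_expMul, ← expMul_nsmul, ← expMul_nsmul, ← expMul_nsmul, ← expMul_add,
    ← expMul_add, ← umbralSeries_map_C_mul, map_expMul, ← expMul_add, ← expMul_zero]
  set c : ℚ[X] := C (1 / 24) with hc
  have h24 : 24 * c = 1 := by
    rw [hc, show (24 : ℚ[X]) = C 24 from rfl, ← C_mul]; norm_num
  have h24' : 24 * C c = (1 : ℚ[X][X]) := by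
    rw [show (24 : ℚ[X][X]) = C 24 from rfl, ← C_mul, h24, C_1]
  have e1 : algebraMap ℚ ℚ[X] (1 / 4) = 6 * c := by
    rw [hc, show (6 : ℚ[X]) = C 6 from rfl, ← C_mul, algebraMap_eq]; norm_num
  have e2 : algebraMap ℚ ℚ[X] (-1 / 4) = -6 * c := by
    rw [hc, show (6 : ℚ[X]) = C 6 from rfl, ← C_neg, ← C_mul, algebraMap_eq]; norm_num
  have e3 : algebraMap ℚ ℚ[X] (1 / 6) = 4 * c := by
    rw [hc, show (4 : ℚ[X]) = C 4 from rfl, ← C_mul, algebraMap_eq]; norm_num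
  have e4 : algebraMap ℚ ℚ[X] (-1 / 6) = -4 * c := by
    rw [hc, show (4 : ℚ[X]) = C 4 from rfl, ← C_neg, ← C_mul, algebraMap_eq]; norm_num
  have e5 : (C (1 / 2) : ℚ[X]) = 12 * c := by
    rw [hc, show (12 : ℚ[X]) = C 12 from rfl, ← C_mul]; norm_num
  -- the two exponents are the shifts by `± 1 / 4` of one quadratic polynomial
  set p : ℚ[X][X] := C (6 * X + 3) * (X : ℚ[X][X]) - 6 * X ^ 2 - C (X + 8 * c) with hp
  have h := umbralSeries_shift moment_generating_function p
  rw [e1, e2, e3, e4] at h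
  have n1 : (C 3 : ℚ[X][X]) = 3 := rfl
  have n2 : (C 6 : ℚ[X][X]) = 6 := rfl
  have n3 : (C 8 : ℚ[X][X]) = 8 := rfl
  have n4 : (C 12 : ℚ[X][X]) = 12 := rfl
  have n5 : (C 2 : ℚ[X][X]) = 2 := rfl
  have p1 : p.comp (X + C (6 * c)) = umbralExponent := by
    rw [umbralExponent, e5, hp]
    simp only [sub_comp, add_comp, mul_comp, pow_comp, X_comp, C_comp, C_mul, C_add,
      ofNat_comp, n1, n2, n3, n4]
    linear_combination (-3 * X + C X - 9 * C c) * h24'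
  have hmap : (mapRingHom (compRingHom (X + 1 : ℚ[X]))) umbralExponent =
      6 * C (X + 1) * X - 6 * X ^ 2 + C (12 * c * (X + 1) + c) := by
    rw [umbralExponent, e5]
    simp only [coe_mapRingHom, Polynomial.map_add, Polynomial.map_sub,
      Polynomial.map_mul, Polynomial.map_pow, map_X, map_C, Polynomial.map_ofNat,
      coe_compRingHom_apply, X_comp, mul_comp, add_comp, ofNat_comp]
    simp only [hc, C_comp, Nat.cast_ofNat]
  have p2 : p.comp (X + C (-6 * c)) = C (((2 : ℕ) : ℚ[X]) * -1 + ((3 : ℕ) : ℚ[X]) * -X) +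
      (mapRingHom (compRingHom (X + 1 : ℚ[X]))) umbralExponent := by
    rw [hmap, hp]
    simp only [sub_comp, add_comp, mul_comp, pow_comp, X_comp, C_comp, C_mul, C_add,
      C_neg, ofNat_comp, n1, n2, n3, n4, C_1, Nat.cast_ofNat, n5]
    linear_combination (3 * X - 2 * C X - 9 * C c - 2) * h24'
  have p3 : p.eval (4 * c) = 0 := by
    rw [hp]
    simp only [eval_sub, eval_mul, eval_pow, eval_X, eval_C, eval_ofNat]
    linear_combination (X - 4 * c) * h24
  have p4 : p.eval (-4 * c) = -1 + ((2 : ℕ) : ℚ[X]) * -X := by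
    rw [hp]
    simp only [eval_sub, eval_mul, eval_pow, eval_X, eval_C, eval_ofNat,
      Nat.cast_ofNat]
    linear_combination (-X - 4 * c - 1) * h24
  rw [p1, p2, p3, p4] at h
  exact h

end Linearization

/-! ### The formal strange identity -/

open Polynomial in
/-- The series `S` and the umbral series agree, since both solve the functional equation. -/
theorem X_pow_dvd_tailSum_sub_umbralSeries (N : ℕ) :
    PowerSeries.X ^ N ∣ (1 - expMul (-X : ℚ[X])) * tailSum (expMul (-X)) (expMul (-1)) N -
      umbralSeries moment (expMul umbralExponent) := by
  set x := expMul (-X : ℚ[X]) with hx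
  set q := expMul (-1 : ℚ[X]) with hq
  have hcx : PowerSeries.constantCoeff x = 1 := constantCoeff_expMul _
  have hcq : PowerSeries.constantCoeff q = 1 := constantCoeff_expMul _
  have hsx : PowerSeries.map (compRingHom (X + 1)) x = x * q := by
    rw [hx, hq, map_expMul, ← expMul_add]
    congr 1
    simp; ring
  have hsq : PowerSeries.map (compRingHom (X + 1)) q = q := by
    rw [hq, map_expMul]; simp
  apply X_pow_dvd_of_shift (u := q ^ 2 * x ^ 3) (by simp [hcx, hcq])
  have h1 := tailSum_functional_equation x q N
  have h2 : PowerSeries.map (compRingHom (X + 1)) ((1 - x) * tailSum x q N) =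
      (1 - x * q) * tailSum (x * q) q N := by
    simp only [tailSum, map_mul, map_sub, map_one, map_sum, map_prod, map_pow, hsx, hsq]
  have h3 := umbralSeries_functional_equation
  rw [← hx, ← hq] at h3
  rw [map_sub, h2]
  have h4 : (1 - x) * tailSum x q N - umbralSeries moment (expMul umbralExponent) +
      q ^ 2 * x ^ 3 * ((1 - x * q) * tailSum (x * q) q N - PowerSeries.map (compRingHom (X + 1))
        (umbralSeries moment (expMul umbralExponent))) =
      (∏ i ∈ Finset.range N, (1 - x * q ^ (i + 1))) *
        (x ^ (N + 1) - x ^ N - (1 - x * q ^ (N + 1)) * x ^ (N + 1)) := by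
    linear_combination h1 - h3
  rw [h4]
  refine dvd_mul_of_dvd_left ?_ _
  have := Finset.prod_dvd_prod_of_dvd (s := Finset.range N)
    (fun _ => (PowerSeries.X : PowerSeries ℚ[X])) (fun i => 1 - x * q ^ (i + 1))
    (fun i _ => by rw [PowerSeries.X_dvd_iff]; simp [hcx, hcq])
  simpa using this

/-- The power series `∑ₘ 6 (-6) ^ m h_{2 m + 1} t ^ m / m!`. -/
noncomputable def momentSeries : PowerSeries ℚ :=
  PowerSeries.mk fun m => 6 * (-6) ^ m * moment (2 * m + 1) / m.factorial

open Polynomial in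
/-- The part of degree at most one in `M` of the coefficients of the umbral series. -/
theorem coeff_umbralSeries_linear (n : ℕ) :
    ∃ r : ℚ[X], PowerSeries.coeff n (umbralSeries moment
      (expMul (6 * C X * X - 6 * X ^ 2 : ℚ[X][X]))) =
      C ((-6) ^ n * moment (2 * n) / n.factorial) +
        C (n * 6 * (-6) ^ (n - 1) * moment (2 * (n - 1) + 1) / n.factorial) * X + r * X ^ 2 := by
  obtain ⟨k, hk⟩ := powAddExpansion (C (-6) * X ^ 2 : ℚ[X][X]) (C (6 * X) * X) n
  refine ⟨C (1 / n.factorial : ℚ) * umbral moment (k * C 36 * X ^ 2), ?_⟩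
  have e : (6 * C X * X - 6 * X ^ 2 : ℚ[X][X]) = C (-6) * X ^ 2 + C (6 * X) * X := by
    simp only [C_mul, C_neg, show (C 6 : ℚ[X][X]) = 6 from rfl]; ring
  simp only [umbralSeries, PowerSeries.coeff_mk, coeff_expMul]
  rw [IsScalarTower.algebraMap_apply ℚ ℚ[X] ℚ[X][X], algebraMap_eq, algebraMap_eq,
    mul_comm _ (C _), umbral_C_mul, e, hk, map_add, map_add]
  have h1 : umbral moment ((C (-6) * X ^ 2 : ℚ[X][X]) ^ n) = C ((-6) ^ n * moment (2 * n)) := by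
    rw [mul_pow, ← pow_mul, ← C_pow, umbral_monomial, algebraMap_eq, C_mul, C_pow, C_neg]; rfl
  have h2 : umbral moment ((n : ℚ[X][X]) * (C (-6) * X ^ 2 : ℚ[X][X]) ^ (n - 1) * (C (6 * X) * X)) =
      C (n * 6 * (-6) ^ (n - 1) * moment (2 * (n - 1) + 1)) * X := by
    have : (n : ℚ[X][X]) * (C (-6) * X ^ 2 : ℚ[X][X]) ^ (n - 1) * (C (6 * X) * X) =
        C (n * 6 * (-6) ^ (n - 1) * X) * X ^ (2 * (n - 1) + 1) := by
      simp only [C_mul, C_pow, mul_pow, ← pow_mul, C_neg, ← C_eq_natCast]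
      ring
    rw [this, umbral_monomial, algebraMap_eq]
    simp only [C_mul, C_pow, C_neg, map_natCast, show (C 6 : ℚ[X]) = 6 from rfl]
    ring
  have h3 : umbral moment (k * (C (6 * X) * X) ^ 2 : ℚ[X][X]) =
      X ^ 2 * umbral moment (k * C 36 * X ^ 2) := by
    have : k * (C (6 * X) * X) ^ 2 = C (X ^ 2) * (k * C 36 * X ^ 2 : ℚ[X][X]) := by
      have h36 : (C 36 : ℚ[X][X]) = C 6 * C 6 := by rw [← C_mul]; norm_num
      rw [h36, C_mul, C_pow]
      ring
    rw [this, umbral_C_mul]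
  have hC : ∀ r : ℚ, C (r / n.factorial) = C r * C (1 / (n.factorial : ℚ)) := by
    intro r; rw [← C_mul, mul_one_div]
  rw [h1, h2, h3, hC (_ * moment (2 * n)), hC (_ * moment (2 * (n - 1) + 1))]
  generalize C (1 / (n.factorial : ℚ)) = u
  generalize umbral moment (k * C 36 * X ^ 2) = v
  ring

/-- A formal version of Zagier's strange identity: with `q = e ^ (-t)`, the series
`∑ₖ (1 - q) ⋯ (1 - q ^ k)` is `e ^ (t / 24)` times a series with explicit coefficients. -/
theorem X_pow_dvd_tailSum_sub_momentSeries (N : ℕ) :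
    PowerSeries.X ^ N ∣ tailSum 1 (expMul (-1 : ℚ)) (N + 1) - expMul (1 / 24) * momentSeries := by
  -- the value and the derivative at `M = 0`, applied coefficientwise
  set ε : Polynomial ℚ →+* ℚ := Polynomial.constantCoeff
  set δ : PowerSeries (Polynomial ℚ) → PowerSeries ℚ :=
    fun G => PowerSeries.mk fun n => (PowerSeries.coeff n G).coeff 1 with hδ
  have hδmul : ∀ G H, δ (G * H) = δ G * PowerSeries.map ε H + PowerSeries.map ε G * δ H := by
    intro G H
    ext n
    simp only [hδ, PowerSeries.coeff_mk, map_add, PowerSeries.coeff_mul, Polynomial.finsetSum_coeff,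
      PowerSeries.coeff_map, ← Finset.sum_add_distrib]
    refine Finset.sum_congr rfl fun ij _ => ?_
    rw [Polynomial.mul_coeff_one]
    simp only [ε, Polynomial.constantCoeff_apply]
    ring
  have hδsub : ∀ G H, δ (G - H) = δ G - δ H := by
    intro G H; ext n; simp [hδ]
  have hδdvd : ∀ n G, PowerSeries.X ^ n ∣ G → PowerSeries.X ^ n ∣ δ G := by
    intro n G h
    rw [PowerSeries.X_pow_dvd_iff] at h ⊢
    intro m hm
    simp [hδ, h m hm]
  set Z := umbralSeries moment (expMul (6 * Polynomial.C Polynomial.X * Polynomial.X -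
    6 * Polynomial.X ^ 2 : Polynomial (Polynomial ℚ))) with hZ
  set g := expMul (Polynomial.C (1 / 2) * Polynomial.X + Polynomial.C (1 / 24) : Polynomial ℚ)
    with hg
  have hfac : umbralSeries moment (expMul umbralExponent) = g * Z := by
    rw [umbralExponent, add_comm, expMul_add, ← map_expMul, umbralSeries_map_C_mul]
  have hεg : PowerSeries.map ε g = expMul (1 / 24 : ℚ) := by
    rw [hg, map_expMul]; congr 1; simp [ε]
  have hδ1 : δ (1 - expMul (-Polynomial.X)) = PowerSeries.X := by
    ext n
    rw [hδsub, map_sub]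
    simp only [hδ, PowerSeries.coeff_mk, coeff_expMul, PowerSeries.coeff_one, PowerSeries.coeff_X]
    rw [neg_pow, Polynomial.algebraMap_eq, Polynomial.coeff_mul_C,
      show ((-1 : Polynomial ℚ)) = Polynomial.C (-1) by simp, ← Polynomial.C_pow,
      Polynomial.coeff_C_mul, Polynomial.coeff_X_pow]
    rcases n with _ | _ | n
    · simp [Polynomial.coeff_one]
    · simp
    · simp
  have hε1 : PowerSeries.map ε (1 - expMul (-Polynomial.X)) = 0 := by
    rw [map_sub, map_one, map_expMul]; simp [ε, expMul_zero]
  have hεT : PowerSeries.map ε (tailSum (expMul (-Polynomial.X)) (expMul (-1)) (N + 1)) =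
      tailSum 1 (expMul (-1 : ℚ)) (N + 1) := by
    simp only [tailSum, map_sum, map_mul, map_prod, map_sub, map_one, map_pow, map_expMul]
    simp [ε, expMul_zero]
  -- `S` vanishes at `M = 0`, hence so does the umbral series
  have hεZ : PowerSeries.map ε Z = 0 := by
    ext n
    have h := X_pow_dvd_tailSum_sub_umbralSeries (n + 1)
    have h' : PowerSeries.X ^ (n + 1) ∣ PowerSeries.map ε Z := by
      obtain ⟨G, hG⟩ := h
      have := congrArg (PowerSeries.map ε) hG
      rw [map_sub, map_mul, hε1, zero_mul, zero_sub, map_mul, map_pow, PowerSeries.map_X, hfac,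
        map_mul, hεg] at this
      refine ⟨-expMul (-(1 / 24)) * PowerSeries.map ε G, ?_⟩
      have h24 : expMul (-(1 / 24) : ℚ) * expMul (1 / 24) = 1 := by
        rw [← expMul_add]; simp [expMul_zero]
      linear_combination (-expMul (-(1 / 24) : ℚ)) * this - PowerSeries.map ε Z * h24
    exact PowerSeries.X_pow_dvd_iff.mp h' n (Nat.lt_succ_self n)
  have hδZ : δ Z = PowerSeries.X * momentSeries := by
    ext n
    obtain ⟨r, hr⟩ := coeff_umbralSeries_linear n
    simp only [hδ, PowerSeries.coeff_mk]
    rw [hZ, hr]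
    have : (Polynomial.C ((-6) ^ n * moment (2 * n) / n.factorial) +
        Polynomial.C (n * 6 * (-6) ^ (n - 1) * moment (2 * (n - 1) + 1) / n.factorial) *
          Polynomial.X + r * Polynomial.X ^ 2).coeff 1 =
        n * 6 * (-6) ^ (n - 1) * moment (2 * (n - 1) + 1) / n.factorial := by
      rw [Polynomial.coeff_add, Polynomial.coeff_add, Polynomial.coeff_C_mul,
        Polynomial.coeff_mul_X_pow', Polynomial.coeff_C]
      simp
    rw [this]
    cases n with
    | zero => simp
    | succ n =>
      rw [PowerSeries.coeff_succ_X_mul, momentSeries, PowerSeries.coeff_mk, Nat.factorial_succ]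
      push_cast
      field_simp
  have h := hδdvd _ _ (X_pow_dvd_tailSum_sub_umbralSeries (N + 1))
  rw [hδsub, hδmul, hδ1, hε1, hεT, hfac, hδmul, hεZ, hεg, hδZ, mul_zero, zero_mul, zero_add,
    add_zero, mul_left_comm, ← mul_sub, pow_succ', mul_dvd_mul_iff_left PowerSeries.X_ne_zero] at h
  exact h

/-! ### Majorants -/

/-- Coefficientwise domination of a real power series by another one. -/
def Majorized (f F : PowerSeries ℝ) : Prop :=
  ∀ i, |PowerSeries.coeff i f| ≤ PowerSeries.coeff i F

theorem Majorized.nonneg {f F : PowerSeries ℝ} (h : Majorized f F) (i : ℕ) :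
    0 ≤ PowerSeries.coeff i F := (abs_nonneg _).trans (h i)

theorem Majorized.add {f g F G : PowerSeries ℝ} (hf : Majorized f F) (hg : Majorized g G) :
    Majorized (f + g) (F + G) := fun i => by
  rw [map_add, map_add]
  exact (abs_add_le _ _).trans (add_le_add (hf i) (hg i))

theorem Majorized.mul {f g F G : PowerSeries ℝ} (hf : Majorized f F) (hg : Majorized g G) :
    Majorized (f * g) (F * G) := fun i => by
  rw [PowerSeries.coeff_mul, PowerSeries.coeff_mul]
  refine (Finset.abs_sum_le_sum_abs _ _).trans (Finset.sum_le_sum fun ij _ => ?_)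
  rw [abs_mul]
  exact mul_le_mul (hf _) (hg _) (abs_nonneg _) (hf.nonneg _)

theorem Majorized.one : Majorized 1 1 := fun i => by
  rw [PowerSeries.coeff_one]; split_ifs <;> simp

theorem Majorized.pow {f F : PowerSeries ℝ} (hf : Majorized f F) (n : ℕ) :
    Majorized (f ^ n) (F ^ n) := by
  induction n with
  | zero => simpa using Majorized.one
  | succ n ih => rw [pow_succ, pow_succ]; exact ih.mul hf

/-- The geometric series `1 / (1 - B X)`. -/
noncomputable def geom (B : ℝ) : PowerSeries ℝ := PowerSeries.mk fun i => B ^ i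

theorem coeff_geom_pow_succ (B : ℝ) (m j : ℕ) :
    PowerSeries.coeff j (geom B ^ (m + 1)) = B ^ j * ((m + j).choose j : ℝ) := by
  have h : geom B = PowerSeries.rescale B (PowerSeries.mk 1) := by
    ext i; simp [geom, PowerSeries.coeff_rescale]
  rw [h, ← map_pow, PowerSeries.coeff_rescale, PowerSeries.mk_one_pow_eq_mk_choose_add,
    PowerSeries.coeff_mk, Nat.choose_symm_add]

theorem one_majorized_geom {B : ℝ} (hB : 0 ≤ B) : Majorized 1 (geom B) := fun i => by
  rw [PowerSeries.coeff_one, geom, PowerSeries.coeff_mk]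
  split_ifs with h
  · simp [h]
  · simpa using pow_nonneg hB i

/-- A power of a series and the same power of its linear part differ by a series of order two. -/
theorem pow_sub_pow_majorized {v p : PowerSeries ℝ} {B : ℝ} (hB : 0 ≤ B)
    (hv : Majorized v (geom B)) (hp : Majorized p (geom B))
    (hvp : Majorized (v - p) (PowerSeries.C (B ^ 2) * PowerSeries.X ^ 2 * geom B)) (m : ℕ) :
    Majorized (v ^ m - p ^ m)
      (PowerSeries.C (m * B ^ 2) * PowerSeries.X ^ 2 * geom B ^ (m + 1)) := by
  have key : Majorized (v ^ m - p ^ m)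
      (PowerSeries.C (m * B ^ 2) * PowerSeries.X ^ 2 * geom B ^ m) := by
    induction m with
    | zero => intro i; simp
    | succ m ih =>
      have h1 : v ^ (m + 1) - p ^ (m + 1) = v * (v ^ m - p ^ m) + (v - p) * p ^ m := by ring
      have h2 : PowerSeries.C (((m + 1 : ℕ) : ℝ) * B ^ 2) * PowerSeries.X ^ 2 * geom B ^ (m + 1) =
          geom B * (PowerSeries.C (m * B ^ 2) * PowerSeries.X ^ 2 * geom B ^ m) +
          PowerSeries.C (B ^ 2) * PowerSeries.X ^ 2 * geom B * geom B ^ m := by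
        push_cast
        rw [add_mul, one_mul, map_add]
        ring
      rw [h1, h2]
      exact (hv.mul ih).add (hvp.mul (hp.pow m))
  have h3 := key.mul (one_majorized_geom hB)
  rwa [mul_one, mul_assoc, ← pow_succ] at h3

theorem choose_pred_le {n j : ℕ} (hj : 1 ≤ j) (hn : 1 ≤ n) :
    ((n - 1).choose (j - 1) : ℝ) = n.choose j * (j / n) := by
  obtain ⟨n, rfl⟩ := Nat.exists_eq_add_of_le' hn
  obtain ⟨j, rfl⟩ := Nat.exists_eq_add_of_le' hj
  have h : ((n + 1 : ℕ) : ℝ) * n.choose j = (n + 1).choose (j + 1) * (j + 1 : ℕ) := by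
    exact_mod_cast Nat.add_one_mul_choose_eq n j
  simp only [Nat.add_sub_cancel]
  field_simp
  push_cast at h ⊢
  linear_combination h

/-- At most `t * (n - 1).choose (j - 1)` of the `j`-subsets of an `n`-set meet a given `t`-subset. -/
theorem choose_sub_le (n t j : ℕ) (hj : 1 ≤ j) :
    n.choose j ≤ (n - t).choose j + t * (n - 1).choose (j - 1) := by
  obtain ⟨j, rfl⟩ := Nat.exists_eq_add_of_le' hj
  simp only [Nat.add_sub_cancel]
  induction t with
  | zero => simp
  | succ t ih =>
    rcases Nat.eq_zero_or_pos (n - t) with h0 | h0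
    · have : n - (t + 1) = n - t := by omega
      rw [this]; nlinarith [Nat.zero_le ((n - 1).choose j)]
    · obtain ⟨s, hs⟩ := Nat.exists_eq_add_of_le' h0
      have h1 : n - (t + 1) = s := by omega
      rw [h1]
      rw [hs, Nat.choose_succ_succ] at ih
      have h2 : s.choose j ≤ (n - 1).choose j := Nat.choose_le_choose j (by omega)
      rw [add_mul, one_mul]
      simp only [Nat.succ_eq_add_one] at ih
      omega

/-- The coefficient of `X ^ j` in `g v ^ (n - j)`, normalized by a binomial coefficient, is
`μ ^ j` up to an error of order `1 / n`. The bounds are uniform in `j`: divided by `j!`, which the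
factorials of the transfer lemma supply, they are summable. -/
theorem coeff_mul_pow_estimate {g v : PowerSeries ℝ} {B G μ : ℝ} (hB : 0 ≤ B) (hG : 1 ≤ G)
    (hv0 : PowerSeries.constantCoeff v = 1) (hv1 : PowerSeries.coeff 1 v = μ)
    (hv : Majorized v (geom B)) (hg0 : PowerSeries.constantCoeff g = 1)
    (hg : Majorized g (PowerSeries.C G * geom B)) {n j : ℕ} (hj : j ≤ n) :
    |PowerSeries.coeff j (g * v ^ (n - j)) / n.choose j| ≤ G * B ^ j ∧
    |PowerSeries.coeff j (g * v ^ (n - j)) / n.choose j - μ ^ j| ≤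
      (G + 2) * B ^ j * (j ^ 2 / n) := by
  have hchoose : (0 : ℝ) < n.choose j := by exact_mod_cast Nat.choose_pos hj
  have hμ : |μ| ≤ B := by
    have := hv 1
    rwa [hv1, geom, PowerSeries.coeff_mk, pow_one] at this
  obtain ⟨m, hm⟩ : ∃ m, m = n - j := ⟨_, rfl⟩
  rw [← hm]
  have hmj : m + j = n := by omega
  constructor
  · rw [abs_div, abs_of_pos hchoose, div_le_iff₀ hchoose]
    have h := (hg.mul (hv.pow m)) j
    rwa [mul_assoc, ← pow_succ', PowerSeries.coeff_C_mul, coeff_geom_pow_succ, hmj,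
      ← mul_assoc] at h
  · rcases Nat.eq_zero_or_pos j with rfl | hjpos
    · simp [hg0, hv0]
    have hnpos : 1 ≤ n := by omega
    have hn' : (1 : ℝ) ≤ n := by exact_mod_cast hnpos
    have hj' : (1 : ℝ) ≤ j := by exact_mod_cast hjpos
    -- replace `g` by `1` (`e1`), `v` by its linear part `p` (`e2`), and `(n - j).choose j` by
    -- `n.choose j` (`e3`)
    set p : PowerSeries ℝ := 1 + PowerSeries.C μ * PowerSeries.X with hp
    have hpB : Majorized p (geom B) := by
      intro i
      rw [hp, geom, map_add, PowerSeries.coeff_mk, PowerSeries.coeff_C_mul, PowerSeries.coeff_one,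
        PowerSeries.coeff_X]
      rcases i with _ | _ | i
      · simp
      · simpa using hμ
      · simpa using pow_nonneg hB (i + 1 + 1)
    have hvp : Majorized (v - p) (PowerSeries.C (B ^ 2) * PowerSeries.X ^ 2 * geom B) := by
      intro i
      have hi := hv i
      rw [hp, map_sub, map_add, PowerSeries.coeff_C_mul, PowerSeries.coeff_one,
        PowerSeries.coeff_X, mul_assoc, PowerSeries.coeff_C_mul, PowerSeries.coeff_X_pow_mul']
      rcases i with _ | _ | i
      · simp [hv0]
      · simp [hv1]
      · rw [geom, PowerSeries.coeff_mk] at hi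
        rw [if_neg (show ¬ i + 1 + 1 = 0 by omega), if_neg (show ¬ i + 1 + 1 = 1 by omega),
          if_pos (show 2 ≤ i + 1 + 1 by omega), geom, PowerSeries.coeff_mk, mul_zero, add_zero,
          sub_zero]
        refine hi.trans (le_of_eq ?_)
        rw [← pow_add]; congr 1; omega
    have hg1 : Majorized (g - 1) (PowerSeries.C (G * B) * PowerSeries.X * geom B) := by
      intro i
      have hi := hg i
      rw [PowerSeries.coeff_C_mul, geom, PowerSeries.coeff_mk] at hi
      rw [map_sub, PowerSeries.coeff_one, mul_assoc, PowerSeries.coeff_C_mul]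
      rcases i with _ | i
      · simp [hg0]
      · rw [PowerSeries.coeff_succ_X_mul, geom, PowerSeries.coeff_mk]
        simp only [Nat.add_eq_zero_iff, one_ne_zero, and_false, if_false, sub_zero]
        refine hi.trans (le_of_eq ?_)
        ring
    have e1 : |PowerSeries.coeff j ((g - 1) * v ^ m)| ≤ G * B ^ j * (n.choose j * (j / n)) := by
      refine ((hg1.mul (hv.pow m)) j).trans (le_of_eq ?_)
      obtain ⟨i, rfl⟩ := Nat.exists_eq_add_of_le' hjpos
      rw [mul_assoc, mul_assoc, PowerSeries.coeff_C_mul, PowerSeries.coeff_succ_X_mul, ← pow_succ',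
        coeff_geom_pow_succ, ← choose_pred_le hjpos hnpos]
      rw [show n - 1 = m + i by omega, show i + 1 - 1 = i by omega]
      ring
    have e2 : |PowerSeries.coeff j (v ^ m - p ^ m)| ≤ B ^ j * (n.choose j * (j ^ 2 / n)) := by
      refine (pow_sub_pow_majorized hB hv hpB hvp m j).trans ?_
      rw [mul_assoc, PowerSeries.coeff_C_mul, PowerSeries.coeff_X_pow_mul']
      split_ifs with h2
      · rw [coeff_geom_pow_succ]
        have hn2 : 1 ≤ n - 1 := by omega
        have h3 := choose_pred_le (n := n - 1) (j := j - 1) (by omega) hn2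
        rw [choose_pred_le hjpos hnpos, Nat.sub_sub, Nat.sub_sub] at h3
        norm_num at h3
        rw [show m + (j - 2) = n - 2 by omega, h3]
        have h4 : B ^ 2 * B ^ (j - 2) = B ^ j := by rw [← pow_add]; congr 1; omega
        have h5 : (0 : ℝ) < ((n - 1 : ℕ) : ℝ) := by exact_mod_cast (by omega : 0 < n - 1)
        have h6 : (m : ℝ) ≤ ((n - 1 : ℕ) : ℝ) := by exact_mod_cast (by omega : m ≤ n - 1)
        have h7 : ((j - 1 : ℕ) : ℝ) ≤ j := by exact_mod_cast Nat.sub_le j 1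
        calc (m : ℝ) * B ^ 2 * (B ^ (j - 2) * (n.choose j * (j / n) *
              (((j - 1 : ℕ) : ℝ) / ((n - 1 : ℕ) : ℝ))))
            = B ^ j * (n.choose j * ((j * ((j - 1 : ℕ) : ℝ)) / n)) * (m / ((n - 1 : ℕ) : ℝ)) := by
              rw [← h4]; ring
          _ ≤ B ^ j * (n.choose j * ((j * j) / n)) * 1 := by
              gcongr
              rw [div_le_one h5]; exact h6
          _ = _ := by ring
      · simp; positivity
    have e3 : |PowerSeries.coeff j (p ^ m) - μ ^ j * n.choose j| ≤
        B ^ j * (n.choose j * (j ^ 2 / n)) := by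
      have hc : PowerSeries.coeff j (p ^ m) = μ ^ j * m.choose j := by
        have : p ^ m = PowerSeries.rescale μ
            (((1 + Polynomial.X) ^ m : Polynomial ℝ) : PowerSeries ℝ) := by
          rw [hp]
          push_cast
          rw [map_pow, map_add, map_one, PowerSeries.rescale_X]
        rw [this, PowerSeries.coeff_rescale, Polynomial.coeff_coe, Polynomial.coeff_one_add_X_pow]
      have h1 := choose_sub_le n j j hjpos
      rw [← hm] at h1
      have h1' : (n.choose j : ℝ) ≤ m.choose j + j * (n.choose j * (j / n)) := by
        rw [← choose_pred_le hjpos hnpos]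
        exact_mod_cast h1
      have h2 : (m.choose j : ℝ) ≤ n.choose j := by
        exact_mod_cast Nat.choose_le_choose j (by omega)
      rw [hc, ← mul_sub, abs_mul, abs_pow]
      gcongr
      rw [abs_le]
      constructor
      · have : (j : ℝ) * (n.choose j * (j / n)) = n.choose j * (j ^ 2 / n) := by ring
        linarith
      · have : (0 : ℝ) ≤ n.choose j * (j ^ 2 / n) := by positivity
        linarith
    have hdecomp : PowerSeries.coeff j (g * v ^ m) / n.choose j - μ ^ j =
        (PowerSeries.coeff j ((g - 1) * v ^ m) + PowerSeries.coeff j (v ^ m - p ^ m) +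
          (PowerSeries.coeff j (p ^ m) - μ ^ j * n.choose j)) / n.choose j := by
      rw [sub_mul, one_mul, map_sub, map_sub]
      field_simp
      ring
    rw [hdecomp, abs_div, abs_of_pos hchoose, div_le_iff₀ hchoose]
    have hjj : (j : ℝ) / n ≤ j ^ 2 / n := by
      gcongr
      nlinarith
    calc _ ≤ _ := abs_add_three _ _ _
      _ ≤ G * B ^ j * (n.choose j * (j ^ 2 / n)) + B ^ j * (n.choose j * (j ^ 2 / n)) +
          B ^ j * (n.choose j * (j ^ 2 / n)) := by
          refine add_le_add (add_le_add (e1.trans ?_) e2) e3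
          gcongr
      _ = _ := by ring

/-! ### Composition of a factorially divergent series with a convergent one -/

/-- The sequence `b` satisfies `b n = n! R ^ n (K √n + O(1 / √n))`. The error bound is required for
all `n`, whence the shifted argument of its square root. -/
def FactorialGrowth (b : ℕ → ℝ) (R K : ℝ) : Prop :=
  ∃ C : ℝ, ∀ n : ℕ, |b n / (n.factorial * R ^ n) - K * √n| ≤ C / √(n + 1)

/-- The normalized terms `β (n - j)` and `K √n` are close for small `j`; the bound is polynomial
in `j`. -/
theorem abs_sub_le_of_shift {β : ℕ → ℝ} {K C : ℝ}
    (h : ∀ n : ℕ, |β n - K * √n| ≤ C / √(n + 1)) {n j : ℕ} (hj : j ≤ n) :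
    |β (n - j) - K * √n| ≤ (C + 2 * |K|) * (j + 1) / √(n + 1) := by
  have hC : 0 ≤ C := by
    have := (abs_nonneg _).trans (h 0)
    simpa using this
  obtain ⟨m, rfl⟩ := Nat.exists_eq_add_of_le' hj
  rw [Nat.add_sub_cancel]
  have hs : 0 < √((m + j : ℕ) + 1 : ℝ) := by positivity
  have h1 : C / √(m + 1 : ℝ) ≤ C * (j + 1) / √((m + j : ℕ) + 1 : ℝ) := by
    rw [div_le_div_iff₀ (by positivity) hs, mul_assoc]
    gcongr
    rw [Real.sqrt_le_iff]
    refine ⟨by positivity, ?_⟩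
    rw [mul_pow, Real.sq_sqrt (by positivity)]
    push_cast
    have : (0 : ℝ) ≤ j := j.cast_nonneg
    have : (0 : ℝ) ≤ m := m.cast_nonneg
    nlinarith [mul_nonneg ‹(0 : ℝ) ≤ j› ‹(0 : ℝ) ≤ m›,
      mul_nonneg (mul_nonneg ‹(0 : ℝ) ≤ j› ‹(0 : ℝ) ≤ j›) ‹(0 : ℝ) ≤ m›]
  have h2 : |√(m : ℝ) - √((m + j : ℕ) : ℝ)| ≤ 2 * (j + 1) / √((m + j : ℕ) + 1 : ℝ) := by
    have hle : √(m : ℝ) ≤ √((m + j : ℕ) : ℝ) := Real.sqrt_le_sqrt (by push_cast; simp)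
    rw [abs_of_nonpos (by linarith), le_div_iff₀ hs]
    have ha : √((m + j : ℕ) + 1 : ℝ) ≤ √((m + j : ℕ) : ℝ) + 1 := by
      rw [Real.sqrt_le_iff]
      refine ⟨by positivity, ?_⟩
      nlinarith [Real.sq_sqrt (show (0 : ℝ) ≤ (m + j : ℕ) by positivity),
        Real.sqrt_nonneg ((m + j : ℕ) : ℝ)]
    have hb : (√((m + j : ℕ) : ℝ) - √(m : ℝ)) * √((m + j : ℕ) : ℝ) ≤ j := by
      have e1 := Real.sq_sqrt (show (0 : ℝ) ≤ (m + j : ℕ) by positivity)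
      have e2 := Real.sq_sqrt (show (0 : ℝ) ≤ m by positivity)
      have e3 : (((m + j : ℕ)) : ℝ) = m + j := by push_cast; ring
      nlinarith [Real.sqrt_nonneg (m : ℝ),
        mul_nonneg (Real.sqrt_nonneg (m : ℝ)) (sub_nonneg.mpr hle)]
    have hc : √((m + j : ℕ) : ℝ) - √(m : ℝ) ≤ j + 1 := by
      have : √((m + j : ℕ) : ℝ) ≤ √(m : ℝ) + j := by
        rw [Real.sqrt_le_iff]
        refine ⟨by positivity, ?_⟩
        have e2 := Real.sq_sqrt (show (0 : ℝ) ≤ m by positivity)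
        have e3 : (((m + j : ℕ)) : ℝ) = m + j := by push_cast; ring
        rcases Nat.eq_zero_or_pos j with rfl | hjp
        · simp
        rcases Nat.eq_zero_or_pos m with rfl | hmp
        · have : (1 : ℝ) ≤ j := by exact_mod_cast hjp
          simp; nlinarith
        · have h1 : (1 : ℝ) ≤ √(m : ℝ) := by
            rw [Real.one_le_sqrt]; exact_mod_cast hmp
          have : (0 : ℝ) ≤ j := j.cast_nonneg
          rw [e3]
          nlinarith [mul_le_mul_of_nonneg_left h1 this]
      linarith
    have hd : 0 ≤ √((m + j : ℕ) : ℝ) - √(m : ℝ) := by linarith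
    nlinarith [mul_le_mul_of_nonneg_left ha hd]
  calc |β m - K * √((m + j : ℕ) : ℝ)|
      = |(β m - K * √(m : ℝ)) + K * (√(m : ℝ) - √((m + j : ℕ) : ℝ))| := by congr 1; ring
    _ ≤ C * (j + 1) / √((m + j : ℕ) + 1 : ℝ) +
        |K| * (2 * (j + 1) / √((m + j : ℕ) + 1 : ℝ)) := by
        refine (abs_add_le _ _).trans (add_le_add ((h m).trans h1) ?_)
        rw [abs_mul]
        gcongr
    _ = _ := by ring

/-- Composition of a factorially divergent series `∑ b m t ^ m` with the convergent series
`t = l X v(X)`, `v = 1 + μ X + ⋯`, followed by multiplication with a convergent series `g`. Only the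
terms with `m` close to `n` contribute to the coefficient of `X ^ n`: the `j`-th of them,
`m = n - j`, contributes a fraction `(μ / (R l)) ^ j / j!` of `b n l ^ n`. -/
theorem FactorialGrowth.transfer {b : ℕ → ℝ} {R K : ℝ} (hb : FactorialGrowth b R K) (hR : 0 < R)
    {l : ℝ} (hl : 0 < l) {g v : PowerSeries ℝ} {B G μ : ℝ} (hB : 0 ≤ B) (hG : 1 ≤ G)
    (hv0 : PowerSeries.constantCoeff v = 1) (hv1 : PowerSeries.coeff 1 v = μ)
    (hv : Majorized v (geom B)) (hg0 : PowerSeries.constantCoeff g = 1)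
    (hg : Majorized g (PowerSeries.C G * geom B)) :
    FactorialGrowth (fun n => ∑ m ∈ Finset.range (n + 1), b m *
      PowerSeries.coeff n (g * (PowerSeries.C l * PowerSeries.X * v) ^ m)) (R * l)
      (K * Real.exp (μ / (R * l))) := by
  obtain ⟨C, hC⟩ := hb
  set β : ℕ → ℝ := fun n => b n / (n.factorial * R ^ n) with hβ
  set r : ℝ := (R * l)⁻¹ with hr
  have hrpos : 0 < r := by positivity
  have hC0 : 0 ≤ C := by
    have := (abs_nonneg _).trans (hC 0)
    simpa using this
  set γ : ℕ → ℕ → ℝ := fun n j => PowerSeries.coeff j (g * v ^ (n - j)) / n.choose j with hγ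
  have hsum : ∀ n : ℕ, (∑ m ∈ Finset.range (n + 1), b m *
      PowerSeries.coeff n (g * (PowerSeries.C l * PowerSeries.X * v) ^ m)) /
        (n.factorial * (R * l) ^ n) =
      ∑ j ∈ Finset.range (n + 1), β (n - j) * (r ^ j * γ n j / j.factorial) := by
    intro n
    rw [← Finset.sum_range_reflect, Finset.sum_div]
    refine Finset.sum_congr rfl fun j hj => ?_
    have hjn : j ≤ n := Nat.lt_succ_iff.mp (Finset.mem_range.mp hj)
    obtain ⟨m, hm⟩ := Nat.exists_eq_add_of_le' hjn
    have e1 : n + 1 - 1 - j = m := by omega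
    have e2 : n - j = m := by omega
    have e3 : PowerSeries.coeff n (g * (PowerSeries.C l * PowerSeries.X * v) ^ m) =
        l ^ m * PowerSeries.coeff j (g * v ^ m) := by
      have : g * (PowerSeries.C l * PowerSeries.X * v) ^ m =
          PowerSeries.C (l ^ m) * (PowerSeries.X ^ m * (g * v ^ m)) := by
        rw [mul_pow, mul_pow, map_pow]; ring
      rw [this, PowerSeries.coeff_C_mul, hm, add_comm m j, PowerSeries.coeff_X_pow_mul]
    rw [e1, e3]
    simp only [hβ, hγ, e2, hr]
    have hch : ((n.choose j : ℕ) : ℝ) * j.factorial * m.factorial = n.factorial := by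
      have := Nat.choose_mul_factorial_mul_factorial hjn
      rw [e2] at this
      exact_mod_cast this
    have hchoose : (0 : ℝ) < n.choose j := by exact_mod_cast Nat.choose_pos hjn
    rw [← hch, hm, pow_add, mul_pow, mul_pow, inv_pow, mul_pow]
    have := Nat.factorial_pos j
    have := Nat.factorial_pos m
    rw [hm] at hchoose
    field_simp
  set C2 : ℝ := (C + 2 * |K|) * G + 2 * |K| * (G + 2) with hC2
  have hKC2 : |K| ≤ C2 := by
    have : 0 ≤ |K| := abs_nonneg K
    have : 0 ≤ C * G := by positivity
    have : |K| ≤ |K| * G := by nlinarith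
    nlinarith
  have hC2nn : 0 ≤ C2 := (abs_nonneg K).trans hKC2
  have hμ : |μ| ≤ B := by
    have := hv 1
    rwa [hv1, geom, PowerSeries.coeff_mk, pow_one] at this
  refine ⟨C2 * Real.exp (4 * (r * B)), fun n => ?_⟩
  rw [hsum]
  have hs : 0 < √((n : ℝ) + 1) := by positivity
  -- the sum is compared termwise with `K √n` times the exponential series; the terms with `j > n`
  -- of the latter obey the same bound
  have hterm : ∀ j : ℕ, |(if j ∈ Finset.range (n + 1) then β (n - j) * (r ^ j * γ n j / j.factorial)
      else 0) - K * √n * ((μ * r) ^ j / j.factorial)| ≤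
      C2 / √(n + 1) * ((4 * (r * B)) ^ j / j.factorial) := by
    intro j
    have hj2 : ((j : ℝ) + 1) ^ 2 ≤ 4 ^ j := by
      have : (j : ℝ) + 1 ≤ 2 ^ j := by exact_mod_cast Nat.lt_two_pow_self (n := j)
      calc ((j : ℝ) + 1) ^ 2 ≤ (2 ^ j) ^ 2 := by gcongr
        _ = 4 ^ j := by rw [← pow_mul, mul_comm, pow_mul]; norm_num
    have hfac : (0 : ℝ) < j.factorial := by exact_mod_cast Nat.factorial_pos j
    have hred : ∀ x : ℝ, |x| ≤ C2 * B ^ j * (j + 1) ^ 2 / √(n + 1) →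
        |x * (r ^ j / j.factorial)| ≤ C2 / √(n + 1) * ((4 * (r * B)) ^ j / j.factorial) := by
      intro x hx
      rw [abs_mul, abs_of_pos (show 0 < r ^ j / (j.factorial : ℝ) by positivity)]
      calc |x| * (r ^ j / j.factorial)
          ≤ C2 * B ^ j * 4 ^ j / √(n + 1) * (r ^ j / j.factorial) := by
            gcongr
            exact hx.trans (by gcongr)
        _ = _ := by rw [mul_pow, mul_pow]; ring
    split_ifs with hj
    · have hjn : j ≤ n := Nat.lt_succ_iff.mp (Finset.mem_range.mp hj)
      have hest := coeff_mul_pow_estimate hB hG hv0 hv1 hv hg0 hg hjn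
      have hsh := abs_sub_le_of_shift hC hjn
      have e : β (n - j) * (r ^ j * γ n j / j.factorial) - K * √n * ((μ * r) ^ j / j.factorial) =
          ((β (n - j) - K * √n) * γ n j + K * √n * (γ n j - μ ^ j)) * (r ^ j / j.factorial) := by
        rw [mul_pow]; ring
      rw [e]
      apply hred
      have hn2 : √(n : ℝ) * ((j : ℝ) ^ 2 / n) ≤ 2 * (j + 1) ^ 2 / √(n + 1) := by
        rcases Nat.eq_zero_or_pos n with rfl | hn
        · simp; positivity
        have hn' : (1 : ℝ) ≤ n := by exact_mod_cast hn
        have h1 : √(n : ℝ) * ((j : ℝ) ^ 2 / n) = (j : ℝ) ^ 2 / √n := by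
          have h2 := Real.mul_self_sqrt (show (0 : ℝ) ≤ n by positivity)
          have h3 : 0 < √(n : ℝ) := Real.sqrt_pos.mpr (by linarith)
          rw [mul_div_assoc', div_eq_div_iff (by positivity) (by positivity)]
          linear_combination (j : ℝ) ^ 2 * h2
        rw [h1, div_le_div_iff₀ (Real.sqrt_pos.mpr (by linarith)) hs]
        have h4 : √((n : ℝ) + 1) ≤ 2 * √n := by
          rw [Real.sqrt_le_iff]
          refine ⟨by positivity, ?_⟩
          rw [mul_pow, Real.sq_sqrt (by positivity)]
          linarith
        calc (j : ℝ) ^ 2 * √((n : ℝ) + 1) ≤ (j + 1) ^ 2 * (2 * √n) := by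
              gcongr
              linarith
          _ = _ := by ring
      calc |(β (n - j) - K * √n) * γ n j + K * √n * (γ n j - μ ^ j)|
          ≤ (C + 2 * |K|) * (j + 1) / √(n + 1) * (G * B ^ j) +
            |K| * √n * ((G + 2) * B ^ j * (j ^ 2 / n)) := by
            refine (abs_add_le _ _).trans (add_le_add ?_ ?_)
            · rw [abs_mul]
              exact mul_le_mul hsh hest.1 (abs_nonneg _) (by positivity)
            · rw [abs_mul, abs_mul, abs_of_nonneg (Real.sqrt_nonneg (n : ℝ))]
              gcongr
              exact hest.2
        _ ≤ (C + 2 * |K|) * (j + 1) ^ 2 / √(n + 1) * (G * B ^ j) +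
            |K| * ((G + 2) * B ^ j) * (2 * (j + 1) ^ 2 / √(n + 1)) := by
            refine add_le_add ?_ ?_
            · gcongr
              have : (0 : ℝ) ≤ j := j.cast_nonneg
              nlinarith
            · calc |K| * √n * ((G + 2) * B ^ j * (j ^ 2 / n)) =
                  |K| * ((G + 2) * B ^ j) * (√n * (j ^ 2 / n)) := by ring
                _ ≤ _ := by gcongr
        _ = _ := by rw [hC2]; ring
    · have hjn : n < j := by simpa using hj
      have e : 0 - K * √n * ((μ * r) ^ j / j.factorial) =
          (-(K * √n * μ ^ j)) * (r ^ j / j.factorial) := by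
        rw [mul_pow]; ring
      rw [e]
      apply hred
      rw [abs_neg, abs_mul, abs_mul, abs_pow, abs_of_nonneg (Real.sqrt_nonneg (n : ℝ))]
      have h1 : √(n : ℝ) ≤ (j + 1) ^ 2 / √(n + 1) := by
        rw [le_div_iff₀ hs]
        have h2 : √(n : ℝ) ≤ √((n : ℝ) + 1) := Real.sqrt_le_sqrt (by linarith)
        have h3 := Real.mul_self_sqrt (show (0 : ℝ) ≤ (n : ℝ) + 1 by positivity)
        have h4 : (n : ℝ) ≤ j := by exact_mod_cast hjn.le
        nlinarith [n.cast_nonneg (α := ℝ)]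
      calc |K| * √n * |μ| ^ j ≤ C2 * ((j + 1) ^ 2 / √(n + 1)) * B ^ j := by gcongr
        _ = _ := by ring
  have hexp : ∀ x : ℝ, HasSum (fun j : ℕ => x ^ j / (j.factorial : ℝ)) (Real.exp x) := by
    intro x
    rw [Real.exp_eq_exp_ℝ]
    exact NormedSpace.expSeries_div_hasSum_exp x
  have hS1 : HasSum (fun j : ℕ => (if j ∈ Finset.range (n + 1) then
      β (n - j) * (r ^ j * γ n j / j.factorial) else 0))
      (∑ j ∈ Finset.range (n + 1), β (n - j) * (r ^ j * γ n j / j.factorial)) := by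
    have := hasSum_sum_of_ne_finset_zero (L := .unconditional ℕ) (s := Finset.range (n + 1))
      (f := fun j : ℕ =>
      (if j ∈ Finset.range (n + 1) then β (n - j) * (r ^ j * γ n j / j.factorial) else 0))
      (fun j hj => if_neg hj)
    convert! this using 1
    exact Finset.sum_congr rfl fun j hj => (if_pos hj).symm
  have hS := hS1.sub ((hexp (μ * r)).mul_left (K * √n))
  have hD := (hexp (4 * (r * B))).mul_left (C2 / √(n + 1))
  have hfin := hS.norm_le_of_bounded hD hterm
  rw [Real.norm_eq_abs] at hfin
  have e : K * Real.exp (μ / (R * l)) * √n = K * √n * Real.exp (μ * r) := by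
    rw [hr, div_eq_mul_inv]; ring
  rw [e]
  refine hfin.trans (le_of_eq ?_)
  ring

/-! ### Growth of the moments -/

/-- The Fourier expansion of the Bernoulli polynomials makes the twisted Bernoulli numbers
explicit up to an exponentially small relative error. -/
theorem exists_bernoulliTwist_eq : ∃ Z : ℝ, 0 ≤ Z ∧ ∀ m : ℕ, ∃ s : ℝ,
    |s - 2 * √3| ≤ Z / (m + 1) ∧
    (-1 : ℝ) ^ m * (2 * Real.pi) ^ (2 * m + 2) * (bernoulliTwist (2 * m + 2) : ℝ) =
      2 * (2 * m + 2).factorial * s := by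
  have hZ : Summable fun n : ℕ => 1 / ((n : ℝ) + 2) ^ 2 := by
    have := (summable_nat_add_iff 2).mpr (Real.summable_one_div_nat_pow.mpr (le_refl 2))
    simpa using this
  refine ⟨4 * ∑' n : ℕ, 1 / ((n : ℝ) + 2) ^ 2, by positivity, fun m => ?_⟩
  have hs := fun (x : ℝ) (hx : x ∈ Set.Icc (0 : ℝ) 1) =>
    hasSum_one_div_nat_pow_mul_cos (Nat.succ_ne_zero m) hx
  have H := (((hs (1 / 12) (by norm_num)).add (hs (11 / 12) (by norm_num))).sub
    (hs (5 / 12) (by norm_num))).sub (hs (7 / 12) (by norm_num))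
  set f : ℕ → ℝ := fun n => 1 / (n : ℝ) ^ (2 * (m + 1)) * (Real.cos (2 * Real.pi * n * (1 / 12)) +
    Real.cos (2 * Real.pi * n * (11 / 12)) - Real.cos (2 * Real.pi * n * (5 / 12)) -
    Real.cos (2 * Real.pi * n * (7 / 12))) with hf
  set T : ℝ := (-1 : ℝ) ^ m * (2 * Real.pi) ^ (2 * m + 2) / 2 / (2 * m + 2).factorial *
    (bernoulliTwist (2 * m + 2) : ℝ) with hT
  have hcast : ∀ x : ℚ, (Polynomial.map (algebraMap ℚ ℝ) (Polynomial.bernoulli (2 * m + 2))).eval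
      (x : ℝ) = (((Polynomial.bernoulli (2 * m + 2)).eval x : ℚ) : ℝ) := by
    intro x
    have := Polynomial.eval_map_algebraMap (Polynomial.bernoulli (2 * m + 2)) (x : ℝ)
    rw [this]
    exact Polynomial.aeval_algebraMap_apply_eq_algebraMap_eval x _
  have HT : HasSum f T := by
    convert! H using 1
    · funext n; simp only [hf, Nat.succ_eq_add_one]; ring
    · have h1 := hcast (1 / 12)
      have h11 := hcast (11 / 12)
      have h5 := hcast (5 / 12)
      have h7 := hcast (7 / 12)
      push_cast at h1 h11 h5 h7
      simp only [Nat.succ_eq_add_one, show 2 * (m + 1) = 2 * m + 2 by ring]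
      rw [h1, h11, h5, h7, hT, bernoulliTwist]
      push_cast
      ring
  refine ⟨T, ?_, ?_⟩
  · have h2 := (hasSum_nat_add_iff' 2).mpr HT
    have hf0 : f 0 = 0 := by simp [hf]
    have hf1 : f 1 = 2 * √3 := by
      have c1 : Real.cos (2 * Real.pi * (1 : ℕ) * (1 / 12)) = √3 / 2 := by
        rw [← Real.cos_pi_div_six]; congr 1; push_cast; ring
      have c11 : Real.cos (2 * Real.pi * (1 : ℕ) * (11 / 12)) = √3 / 2 := by
        rw [← Real.cos_pi_div_six, ← Real.cos_two_pi_sub]; congr 1; push_cast; ring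
      have c5 : Real.cos (2 * Real.pi * (1 : ℕ) * (5 / 12)) = -(√3 / 2) := by
        rw [← Real.cos_pi_div_six, ← Real.cos_pi_sub]; congr 1; push_cast; ring
      have c7 : Real.cos (2 * Real.pi * (1 : ℕ) * (7 / 12)) = -(√3 / 2) := by
        rw [← Real.cos_pi_div_six, ← Real.cos_add_pi]; congr 1; push_cast; ring
      simp only [hf, c1, c11, c5, c7]
      simp
      ring
    rw [Finset.sum_range_succ, Finset.sum_range_one, hf0, hf1, zero_add] at h2
    have hbound : ∀ n : ℕ, ‖f (n + 2)‖ ≤ 4 / (m + 1) * (1 / ((n : ℝ) + 2) ^ 2) := by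
      intro n
      rw [Real.norm_eq_abs, hf]
      simp only
      rw [abs_mul, abs_of_nonneg (by positivity)]
      have hcos : |Real.cos (2 * Real.pi * (n + 2 : ℕ) * (1 / 12)) +
          Real.cos (2 * Real.pi * (n + 2 : ℕ) * (11 / 12)) -
          Real.cos (2 * Real.pi * (n + 2 : ℕ) * (5 / 12)) -
          Real.cos (2 * Real.pi * (n + 2 : ℕ) * (7 / 12))| ≤ 4 := by
        have c1 := Real.abs_cos_le_one (2 * Real.pi * (n + 2 : ℕ) * (1 / 12))
        have c2 := Real.abs_cos_le_one (2 * Real.pi * (n + 2 : ℕ) * (11 / 12))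
        have c3 := Real.abs_cos_le_one (2 * Real.pi * (n + 2 : ℕ) * (5 / 12))
        have c4 := Real.abs_cos_le_one (2 * Real.pi * (n + 2 : ℕ) * (7 / 12))
        rw [abs_le] at *
        constructor <;> linarith
      have hpow : (m + 1 : ℝ) * ((n : ℝ) + 2) ^ 2 ≤ ((n + 2 : ℕ) : ℝ) ^ (2 * (m + 1)) := by
        push_cast
        rw [show 2 * (m + 1) = 2 * m + 2 by ring, pow_add]
        gcongr
        calc (m + 1 : ℝ) ≤ 2 ^ m := by exact_mod_cast Nat.lt_two_pow_self (n := m)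
          _ ≤ 2 ^ (2 * m) := pow_le_pow_right₀ (by norm_num) (by omega)
          _ ≤ ((n : ℝ) + 2) ^ (2 * m) := by
            gcongr
            linarith [n.cast_nonneg (α := ℝ)]
      calc _ ≤ 1 / ((m + 1 : ℝ) * ((n : ℝ) + 2) ^ 2) * 4 := by gcongr
        _ = _ := by field_simp
    have := h2.norm_le_of_bounded (hZ.hasSum.mul_left _) hbound
    rw [Real.norm_eq_abs] at this
    refine this.trans (le_of_eq ?_)
    ring
  · rw [hT]
    have := Nat.factorial_pos (2 * m + 2)
    field_simp

/-- `(2 m + 1)! / (m!² 4 ^ m) = 2 √(m / π) + O(1 / √m)`, a form of the Wallis product. -/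
theorem abs_factorial_ratio_sub_le (m : ℕ) :
    |((2 * m + 1).factorial : ℝ) / (m.factorial ^ 2 * 4 ^ m) - 2 / √Real.pi * √m| ≤
      2 / √(m + 1) ∧
    ((2 * m + 1).factorial : ℝ) / (m.factorial ^ 2 * 4 ^ m) ≤ 2 * √(m + 1) := by
  set c : ℝ := ((2 * m + 1).factorial : ℝ) / (m.factorial ^ 2 * 4 ^ m) with hc
  have hπ := Real.pi_pos
  have hπ3 := Real.pi_gt_three
  have hcpos : 0 < c := by
    have := Nat.factorial_pos m
    have := Nat.factorial_pos (2 * m + 1)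
    positivity
  have hWpos := Real.Wallis.W_pos m
  have hcW : c ^ 2 * Real.Wallis.W m = 2 * m + 1 := by
    rw [Real.Wallis.W_eq_factorial_ratio, hc, Nat.factorial_succ]
    have := Nat.factorial_pos m
    have := Nat.factorial_pos (2 * m)
    push_cast
    rw [show (4 : ℝ) ^ m = 2 ^ (2 * m) by rw [pow_mul]; norm_num,
      show 4 * m = 2 * m + 2 * m by ring, pow_add]
    field_simp
  have hle := Real.Wallis.W_le m
  have hge := Real.Wallis.le_W m
  have hm : (0 : ℝ) ≤ m := m.cast_nonneg
  have hlow : 2 * (2 * m + 1) ≤ c ^ 2 * Real.pi := by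
    have := mul_le_mul_of_nonneg_left hle (sq_nonneg c)
    rw [hcW] at this
    linarith
  have hupp : c ^ 2 * Real.pi ≤ 4 * m + 4 := by
    have := mul_le_mul_of_nonneg_left hge (sq_nonneg c)
    rw [hcW] at this
    have h2 : c ^ 2 * ((2 * m + 1) / (2 * m + 2) * (Real.pi / 2)) =
      (c ^ 2 * Real.pi) * (2 * m + 1) / (2 * (2 * m + 2)) := by field_simp
    rw [h2, div_le_iff₀ (by positivity)] at this
    nlinarith
  set u : ℝ := 2 / √Real.pi * √m with hu
  have hu2 : u ^ 2 * Real.pi = 4 * m := by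
    rw [hu, mul_pow, div_pow, Real.sq_sqrt hπ.le, Real.sq_sqrt hm]
    field_simp
    norm_num
    ring
  have hu0 : 0 ≤ u := by positivity
  have hs : 0 < √((m : ℝ) + 1) := by positivity
  have hs2 := Real.mul_self_sqrt (show (0 : ℝ) ≤ (m : ℝ) + 1 by positivity)
  constructor
  · have hd : 0 ≤ c - u := by
      by_contra h
      push Not at h
      have h1 : c ^ 2 ≤ u ^ 2 := pow_le_pow_left₀ hcpos.le (by linarith) 2
      linarith [mul_le_mul_of_nonneg_right h1 hπ.le]
    rw [abs_of_nonneg hd, le_div_iff₀ hs]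
    -- `(c - u) (c + u) ≤ 4 / π`, while `c` is at least `√(2 (m + 1) / π)`
    have h1 : (c - u) * (c + u) * Real.pi ≤ 4 := by nlinarith
    have h2 : √((m : ℝ) + 1) * 2 ≤ c * Real.pi := by
      apply le_of_sq_le_sq _ (by positivity)
      have : (√((m : ℝ) + 1) * 2) ^ 2 = 4 * (m + 1) := by nlinarith
      rw [this, mul_pow]
      nlinarith [mul_le_mul_of_nonneg_right hlow hπ.le]
    have h3 : (c - u) * c * Real.pi ≤ 4 := by
      nlinarith [mul_nonneg (mul_nonneg hd hu0) hπ.le]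
    nlinarith [mul_le_mul_of_nonneg_left h2 hd]
  · apply le_of_sq_le_sq _ (by positivity)
    nlinarith

theorem factorialGrowth_momentSeries :
    FactorialGrowth (fun m => ((PowerSeries.coeff m momentSeries : ℚ) : ℝ)) (6 / Real.pi ^ 2)
      (12 * √3 / (Real.pi ^ 2 * √Real.pi)) := by
  obtain ⟨Z, hZ0, hZ⟩ := exists_bernoulliTwist_eq
  refine ⟨3 / Real.pi ^ 2 * (2 * Z + 4 * √3), fun m => ?_⟩
  obtain ⟨s, hs, hD⟩ := hZ m
  obtain ⟨h1, h2⟩ := abs_factorial_ratio_sub_le m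
  set c : ℝ := ((2 * m + 1).factorial : ℝ) / (m.factorial ^ 2 * 4 ^ m) with hc
  have hπ := Real.pi_pos
  have hmf := Nat.factorial_pos m
  have hβ : ((PowerSeries.coeff m momentSeries : ℚ) : ℝ) / (m.factorial * (6 / Real.pi ^ 2) ^ m) =
      3 / Real.pi ^ 2 * (s * c) := by
    have hsgn : ((-1 : ℝ) ^ m) * (-1) ^ m = 1 := by rw [← mul_pow]; simp
    have hD' : (bernoulliTwist (2 * m + 2) : ℝ) =
        (-1) ^ m * (2 * (2 * m + 2).factorial * s) / (2 * Real.pi) ^ (2 * m + 2) := by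
      rw [eq_div_iff (by positivity), ← hD]
      linear_combination (-(bernoulliTwist (2 * m + 2) : ℝ) * (2 * Real.pi) ^ (2 * m + 2)) * hsgn
    rw [momentSeries, PowerSeries.coeff_mk, moment, hc]
    push_cast
    rw [hD', Nat.factorial_succ (2 * m + 1), show (-6 : ℝ) ^ m = (-1) ^ m * 6 ^ m by
      rw [← mul_pow]; norm_num, pow_add, pow_mul, mul_pow, mul_pow, div_pow]
    push_cast
    rw [show ((2 : ℝ) ^ 2) = 4 by norm_num]
    field_simp
    linear_combination (s * 12) * hsgn
  rw [hβ]
  have hs0 : 0 < √((m : ℝ) + 1) := by positivity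
  have hs2 := Real.mul_self_sqrt (show (0 : ℝ) ≤ (m : ℝ) + 1 by positivity)
  have hc0 : 0 ≤ c := by positivity
  have e : 3 / Real.pi ^ 2 * (s * c) - 12 * √3 / (Real.pi ^ 2 * √Real.pi) * √m =
      3 / Real.pi ^ 2 * ((s - 2 * √3) * c + 2 * √3 * (c - 2 / √Real.pi * √m)) := by
    field_simp; ring
  rw [e, abs_mul, abs_of_pos (by positivity), mul_div_assoc]
  gcongr
  calc |(s - 2 * √3) * c + 2 * √3 * (c - 2 / √Real.pi * √m)|
      ≤ Z / (m + 1) * (2 * √(m + 1)) + 2 * √3 * (2 / √(m + 1)) := by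
        refine (abs_add_le _ _).trans (add_le_add ?_ ?_)
        · rw [abs_mul, abs_of_nonneg hc0]
          gcongr
        · rw [abs_mul, abs_of_nonneg (by positivity)]
          gcongr
    _ = _ := by
        rw [show Z / ((m : ℝ) + 1) = Z / (√((m : ℝ) + 1) * √((m : ℝ) + 1)) by rw [hs2]]
        generalize √((m : ℝ) + 1) = S at hs0
        field_simp
        ring

/-! ### Composition with the logarithm -/

section Logarithm

open PowerSeries

variable {f : PowerSeries ℚ}

theorem hasSubst_logOf (hf : constantCoeff f = 1) : HasSubst (logOf f) :=
  HasSubst.of_constantCoeff_zero' (constantCoeff_logOf hf)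

theorem mul_derivative_logOf (hf : constantCoeff f = 1) :
    f * derivative ℚ (logOf f) = derivative ℚ f := by
  have hs : HasSubst (f - 1) := HasSubst.of_constantCoeff_zero' (by simp [hf])
  have h1 : (1 + X) * derivative ℚ (log ℚ) = 1 := by
    rw [deriv_log]
    ext n
    rw [add_mul, one_mul, map_add]
    cases n with
    | zero => simp
    | succ n => rw [coeff_succ_X_mul]; simp [coeff_one, pow_succ]
  have h2 : f * subst (f - 1) (derivative ℚ (log ℚ)) = 1 := by
    have h3 := congrArg (substAlgHom hs) h1
    rw [map_mul, map_add, map_one, substAlgHom_X, coe_substAlgHom] at h3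
    simpa using h3
  rw [logOf_eq, derivative_subst hs, ← mul_assoc, h2, one_mul, map_sub]
  simp

/-- The quotient of the two sides has derivative zero. -/
theorem exp_subst_logOf (hf : constantCoeff f = 1) : (exp ℚ).subst (logOf f) = f := by
  have hs := hasSubst_logOf hf
  have hf0 : constantCoeff f ≠ 0 := by rw [hf]; exact one_ne_zero
  set G : PowerSeries ℚ := (exp ℚ).subst (logOf f) with hG
  have hdG : derivative ℚ G = G * derivative ℚ (logOf f) := by
    rw [hG, derivative_subst hs, derivative_exp]
  have hcG : constantCoeff G = 1 := by
    have h1 : X ∣ exp ℚ - 1 := by rw [X_dvd_iff]; simp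
    obtain ⟨E, hE⟩ := h1
    have h2 := congrArg (substAlgHom hs) hE
    rw [map_sub, map_mul, map_one, substAlgHom_X, coe_substAlgHom, ← hG] at h2
    have h3 := congrArg (constantCoeff (R := ℚ)) h2
    have h4 := constantCoeff_logOf hf
    rw [map_sub, map_mul, map_one] at h3
    change constantCoeff G - 1 = constantCoeff (logOf f) * _ at h3
    rw [h4, zero_mul] at h3
    linarith
  have key : G * f⁻¹ = 1 := by
    apply derivative.ext
    · rw [Derivation.leibniz, derivative_inv', hdG, ← mul_derivative_logOf hf]
      simp only [smul_eq_mul, Derivation.map_one_eq_zero]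
      linear_combination (-G * derivative ℚ (logOf f) * f⁻¹) * PowerSeries.mul_inv_cancel f hf0
    · rw [map_mul, hcG, map_one, constantCoeff_inv, hf]; norm_num
  calc G = G * (f * f⁻¹) := by rw [PowerSeries.mul_inv_cancel f hf0, mul_one]
    _ = (G * f⁻¹) * f := by ring
    _ = f := by rw [key, one_mul]

/-- The recursion for the coefficients of a logarithm. -/
theorem coeff_logOf_succ (hf : constantCoeff f = 1) (n : ℕ) :
    (n + 1 : ℚ) * coeff (n + 1) (logOf f) = (n + 1) * coeff (n + 1) f -
      ∑ i ∈ Finset.range n, coeff (i + 1) f * ((n - i : ℕ) * coeff (n - i) (logOf f)) := by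
  have h := congrArg (coeff n) (mul_derivative_logOf hf)
  rw [coeff_mul, coeff_derivative, Finset.Nat.sum_antidiagonal_eq_sum_range_succ_mk,
    Finset.sum_range_succ'] at h
  simp only [coeff_zero_eq_constantCoeff_apply, hf, one_mul, coeff_derivative, Nat.sub_zero] at h
  have h2 : ∑ i ∈ Finset.range n, coeff (i + 1) f * ((n - i : ℕ) * coeff (n - i) (logOf f)) =
      ∑ i ∈ Finset.range n, coeff (i + 1) f *
        (coeff (n - (i + 1) + 1) (logOf f) * ((n - (i + 1) : ℕ) + 1)) := by
    refine Finset.sum_congr rfl fun i hi => ?_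
    have hi := Finset.mem_range.mp hi
    rw [show n - i = n - (i + 1) + 1 by omega]
    push_cast
    ring
  rw [h2]
  linear_combination h

theorem coeff_one_logOf (hf : constantCoeff f = 1) : coeff 1 (logOf f) = coeff 1 f := by
  have := coeff_logOf_succ hf 0
  simpa using this

theorem coeff_two_logOf (hf : constantCoeff f = 1) :
    coeff 2 (logOf f) = coeff 2 f - coeff 1 f ^ 2 / 2 := by
  have := coeff_logOf_succ hf 1
  simp only [Finset.sum_range_one, coeff_one_logOf hf, Nat.sub_zero] at this
  norm_num at this
  linarith

theorem abs_coeff_logOf_le (hf : constantCoeff f = 1) {A : ℝ} (hA : 0 ≤ A)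
    (h : ∀ i, |((coeff (i + 1) f : ℚ) : ℝ)| ≤ A ^ (i + 1)) (n : ℕ) :
    |((coeff (n + 1) (logOf f) : ℚ) : ℝ)| ≤ (2 * A) ^ (n + 1) := by
  induction n using Nat.strong_induction_on with
  | _ n ih =>
  have hrec : ((n : ℝ) + 1) * ((coeff (n + 1) (logOf f) : ℚ) : ℝ) =
      (n + 1) * ((coeff (n + 1) f : ℚ) : ℝ) - ∑ i ∈ Finset.range n, ((coeff (i + 1) f : ℚ) : ℝ) *
        ((n - i : ℕ) * ((coeff (n - i) (logOf f) : ℚ) : ℝ)) := by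
    exact_mod_cast congrArg (fun x : ℚ => (x : ℝ)) (coeff_logOf_succ hf n)
  have hn : (0 : ℝ) < n + 1 := by positivity
  have hsum : |∑ i ∈ Finset.range n, ((coeff (i + 1) f : ℚ) : ℝ) *
        ((n - i : ℕ) * ((coeff (n - i) (logOf f) : ℚ) : ℝ))| ≤
      ∑ i ∈ Finset.range n, (n + 1) * A ^ (n + 1) * 2 ^ (n - i) := by
    refine (Finset.abs_sum_le_sum_abs _ _).trans (Finset.sum_le_sum fun i hi => ?_)
    have hi := Finset.mem_range.mp hi
    obtain ⟨m, hm⟩ : ∃ m, n - i = m + 1 := ⟨n - i - 1, by omega⟩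
    rw [hm, abs_mul, abs_mul, abs_of_nonneg (Nat.cast_nonneg (α := ℝ) (m + 1))]
    have hcast : ((m + 1 : ℕ) : ℝ) ≤ n + 1 := by
      exact_mod_cast (by omega : m + 1 ≤ n + 1)
    calc _ ≤ A ^ (i + 1) * ((n + 1) * (2 * A) ^ (m + 1)) := by
          gcongr
          · exact h i
          · exact ih m (by omega)
      _ = (n + 1) * A ^ (i + 1 + (m + 1)) * 2 ^ (m + 1) := by rw [mul_pow, pow_add]; ring
      _ = _ := by congr 3; omega
  have hgeo : ∑ i ∈ Finset.range n, (2 : ℝ) ^ (n - i) = 2 ^ (n + 1) - 2 := by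
    rw [← Finset.sum_range_reflect]
    have : ∀ i ∈ Finset.range n, (2 : ℝ) ^ (n - (n - 1 - i)) = 2 * 2 ^ i := by
      intro i hi
      have hi := Finset.mem_range.mp hi
      rw [← pow_succ']; congr 1; omega
    rw [Finset.sum_congr rfl this, ← Finset.mul_sum, geom_sum_eq (by norm_num)]
    rw [pow_succ]; ring
  rw [← Finset.mul_sum, hgeo] at hsum
  have habs : (n + 1 : ℝ) * |((coeff (n + 1) (logOf f) : ℚ) : ℝ)| ≤
      (n + 1) * (2 * A) ^ (n + 1) := by
    calc (n + 1 : ℝ) * |((coeff (n + 1) (logOf f) : ℚ) : ℝ)|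
        = |(n + 1 : ℝ) * ((coeff (n + 1) (logOf f) : ℚ) : ℝ)| := by rw [abs_mul, abs_of_pos hn]
      _ ≤ (n + 1) * A ^ (n + 1) + (n + 1) * A ^ (n + 1) * (2 ^ (n + 1) - 2) := by
          rw [hrec]
          refine (abs_sub _ _).trans (add_le_add ?_ hsum)
          rw [abs_mul, abs_of_pos hn]
          gcongr
          exact h n
      _ ≤ _ := by
          rw [mul_pow]
          have : 0 ≤ (n + 1 : ℝ) * A ^ (n + 1) := by positivity
          nlinarith
  exact le_of_mul_le_mul_left habs hn

end Logarithm

/-- The Fishburn series of `f` is the composition of an explicit series with `log f`. -/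
theorem coeff_fishburnSeries_eq_sum {f : PowerSeries ℚ} (hf : PowerSeries.constantCoeff f = 1)
    (n : ℕ) : PowerSeries.coeff n (fishburnSeries f) = ∑ m ∈ Finset.range (n + 1),
      PowerSeries.coeff m (expMul (1 / 24) * momentSeries) *
        PowerSeries.coeff n (PowerSeries.logOf f ^ m) := by
  have hs := hasSubst_logOf hf
  have hf0 : PowerSeries.constantCoeff f ≠ 0 := by rw [hf]; exact one_ne_zero
  set φ := PowerSeries.substAlgHom (R := ℚ) hs with hφ
  have hX : PowerSeries.X ∣ PowerSeries.logOf f :=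
    PowerSeries.X_dvd_iff.mpr (PowerSeries.constantCoeff_logOf hf)
  have hq : φ (expMul (-1)) = f⁻¹ := by
    have h1 : expMul (-1 : ℚ) * PowerSeries.exp ℚ = 1 := by
      have : PowerSeries.exp ℚ = expMul 1 := by simp [expMul]
      rw [this, ← expMul_add, neg_add_cancel, expMul_zero]
    have h2 := congrArg φ h1
    rw [map_mul, map_one, hφ, PowerSeries.coe_substAlgHom, exp_subst_logOf hf] at h2
    rw [hφ, PowerSeries.coe_substAlgHom]
    exact (PowerSeries.eq_inv_iff_mul_eq_one hf0).mpr h2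
  have h1 : PowerSeries.X ^ (n + 1) ∣ φ (tailSum 1 (expMul (-1 : ℚ)) (n + 1 + 1)) -
      φ (expMul (1 / 24) * momentSeries) := by
    obtain ⟨G, hG⟩ := X_pow_dvd_tailSum_sub_momentSeries (n + 1)
    rw [← map_sub, hG, map_mul, map_pow, hφ, PowerSeries.substAlgHom_X]
    exact dvd_mul_of_dvd_left (pow_dvd_pow_of_dvd hX _) _
  have h2 : φ (tailSum 1 (expMul (-1 : ℚ)) (n + 1 + 1)) =
      ∑ a ∈ Finset.range (n + 1 + 1), ∏ j ∈ Finset.Icc 1 a, (1 - (f ^ j)⁻¹) := by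
    simp only [tailSum, map_sum, map_prod, map_sub, map_one, map_pow, hq, one_mul,
      one_pow, mul_one]
    refine Finset.sum_congr rfl fun a _ => ?_
    rw [Finset.range_eq_Ico, Finset.prod_Ico_add' (fun j => 1 - f⁻¹ ^ j) 0 a 1, zero_add,
      Finset.Ico_add_one_right_eq_Icc]
    refine Finset.prod_congr rfl fun j _ => ?_
    congr 1
    rw [eq_comm, PowerSeries.inv_eq_iff_mul_eq_one (by simp [hf]), ← mul_pow,
      PowerSeries.inv_mul_cancel f hf0, one_pow]
  have h3 := PowerSeries.X_pow_dvd_iff.mp h1 n (Nat.lt_succ_self n)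
  rw [map_sub, sub_eq_zero, h2] at h3
  rw [coeff_fishburnSeries hf (show n < n + 1 + 1 by omega), h3, hφ, PowerSeries.coe_substAlgHom,
    PowerSeries.coeff_subst' hs]
  simp only [smul_eq_mul]
  refine finsum_eq_sum_of_support_subset _ fun m hm => ?_
  by_contra hmn
  refine hm ?_
  simp only [Finset.coe_range, Set.mem_Iio] at hmn
  have : PowerSeries.coeff n (PowerSeries.logOf f ^ m) = 0 :=
    PowerSeries.X_pow_dvd_iff.mp (pow_dvd_pow_of_dvd hX m) n (by omega)
  simp [this]

/-! ### Stirling's formula and the asymptotic count -/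

/-- Stirling's formula with a rate: by Robbins' stepwise bound, `log (stirlingSeq n) - 1 / (2 n)`
increases to its limit `log √π`. -/
theorem factorial_div_stirling_le {n : ℕ} (hn : n ≠ 0) :
    Stirling.stirlingSeq n / √Real.pi ∈ Set.Icc (1 : ℝ) (1 + 1 / n) := by
  have hπ : 0 < √Real.pi := Real.sqrt_pos.mpr Real.pi_pos
  refine ⟨(one_le_div hπ).mpr (Stirling.sqrt_pi_le_stirlingSeq hn), ?_⟩
  set t : ℕ → ℝ := fun k => Real.log (Stirling.stirlingSeq (k + 1)) - 1 / (2 * (k + 1)) with ht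
  have hmono : Monotone t := by
    refine monotone_nat_of_le_succ fun k => ?_
    have h := Stirling.log_stirlingSeq_sdiff_le (k + 1)
    have h2 : (1 : ℝ) / (12 * (k + 1 : ℕ) * ((k + 1 : ℕ) + 1)) ≤
        1 / (2 * (k + 1)) - 1 / (2 * ((k + 1 : ℕ) + 1)) := by
      push_cast
      rw [div_sub_div _ _ (by positivity) (by positivity),
        div_le_div_iff₀ (by positivity) (by positivity)]
      have : (0 : ℝ) ≤ k := k.cast_nonneg
      nlinarith [mul_nonneg this this]
    simp only [ht]
    push_cast at h h2 ⊢
    rw [show k + 1 + 1 = k + 2 from rfl]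
    linarith
  have hlim : Tendsto t atTop (nhds (Real.log √Real.pi - 0)) := by
    refine Tendsto.sub ?_ ?_
    · exact (Stirling.tendsto_stirlingSeq_sqrt_pi.comp (tendsto_add_atTop_nat 1)).log hπ.ne'
    · have h := (tendsto_one_div_add_atTop_nhds_zero_nat (𝕜 := ℝ)).const_mul (1 / 2)
      rw [mul_zero] at h
      refine h.congr fun k => ?_
      field_simp
  obtain ⟨k, rfl⟩ := Nat.exists_eq_succ_of_ne_zero hn
  have hle := hmono.ge_of_tendsto hlim k
  simp only [ht, sub_zero] at hle
  have hspos : 0 < Stirling.stirlingSeq (k + 1) := Stirling.stirlingSeq'_pos k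
  have h1 : Real.log (Stirling.stirlingSeq (k + 1) / √Real.pi) ≤ 1 / (2 * (k + 1)) := by
    rw [Real.log_div hspos.ne' hπ.ne']; linarith
  have h2 : Stirling.stirlingSeq (k + 1) / √Real.pi ≤ Real.exp (1 / (2 * (k + 1))) := by
    rwa [← Real.log_le_iff_le_exp (by positivity)]
  refine h2.trans ?_
  have hk : (0 : ℝ) ≤ k := k.cast_nonneg
  set x : ℝ := 1 / (2 * (k + 1)) with hx
  have hx0 : 0 < x := by positivity
  have hx1 : x ≤ 1 / 2 := by
    rw [hx, div_le_div_iff₀ (by positivity) (by norm_num)]; linarith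
  have h3 : 1 - x ≤ Real.exp (-x) := Real.one_sub_le_exp_neg x
  have h4 : Real.exp x * Real.exp (-x) = 1 := by rw [← Real.exp_add]; simp
  have h5 : (1 : ℝ) / (k + 1 : ℕ) = 2 * x := by rw [hx]; push_cast; field_simp
  rw [Nat.succ_eq_add_one, h5]
  have h6 := Real.exp_pos x
  have h7 : Real.exp x * (1 - x) ≤ 1 := by
    exact (mul_le_mul_of_nonneg_left h3 h6.le).trans_eq h4
  nlinarith

/-- Stirling's formula turns factorial growth into the asymptotic form of the statement. -/
theorem FactorialGrowth.asympEq {a : ℕ → ℝ} {R K : ℝ} (h : FactorialGrowth a R K) (hR : 0 < R)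
    (hK : 0 < K) : AsympEq a fun n =>
      K * √(2 * Real.pi) * (R / Real.exp 1) ^ n * (n : ℝ) ^ (n + 1) := by
  obtain ⟨C, hC⟩ := h
  have hC0 : 0 ≤ C := by
    have := (abs_nonneg _).trans (hC 0)
    simpa using this
  have hπ := Real.pi_pos
  set b : ℕ → ℝ := fun n => K * √(2 * Real.pi) * (R / Real.exp 1) ^ n * (n : ℝ) ^ (n + 1) with hb
  have hbpos : ∀ n : ℕ, 1 ≤ n → 0 < b n := by
    intro n hn
    have : (0 : ℝ) < n := by exact_mod_cast hn
    have := Real.exp_pos 1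
    positivity
  refine ⟨fun n => a n / b n - 1, ?_, ?_⟩
  · refine IsBigO.of_bound (1 + 2 * (C / K)) ?_
    filter_upwards [eventually_ge_atTop 1] with n hn
    have hn' : (1 : ℝ) ≤ n := by exact_mod_cast hn
    have hnpos : (0 : ℝ) < n := by linarith
    set α : ℝ := a n / (n.factorial * R ^ n) with hα
    set s : ℝ := Stirling.stirlingSeq n / √Real.pi with hs
    have hst := factorial_div_stirling_le (n := n) (by omega)
    rw [← hs, Set.mem_Icc] at hst
    have hsn := Real.mul_self_sqrt hnpos.le
    have hsnpos : 0 < √(n : ℝ) := Real.sqrt_pos.mpr hnpos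
    have hratio : a n / b n = s * (α / (K * √n)) := by
      rw [div_eq_iff (hbpos n hn).ne', hs, hα, hb, Stirling.stirlingSeq]
      have h2 : √(2 * (n : ℝ)) = √2 * √n := Real.sqrt_mul (by norm_num) _
      have h3 : √(2 * Real.pi) = √2 * √Real.pi := Real.sqrt_mul (by norm_num) _
      have h4 : 0 < √Real.pi := Real.sqrt_pos.mpr hπ
      have h5 := Real.exp_pos 1
      have := Nat.factorial_pos n
      simp only [h2, h3, div_pow]
      rw [pow_succ, ← hsn]
      have hR' : (0 : ℝ) < R ^ n := by positivity
      field_simp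
      rw [Real.sqrt_sq hsnpos.le]
    have hδ : |α / (K * √n) - 1| ≤ C / K * (1 / n) := by
      have h1 := hC n
      rw [← hα] at h1
      have e : α / (K * √n) - 1 = (α - K * √n) / (K * √n) := by field_simp
      rw [e, abs_div, abs_of_pos (show 0 < K * √n by positivity), div_le_iff₀ (by positivity)]
      refine h1.trans ?_
      calc C / √((n : ℝ) + 1) ≤ C / √n := by
            gcongr
            linarith
        _ = C / K * (1 / n) * (K * √n) := by
            field_simp
            linear_combination (-C) * hsn
    have hinv : (1 : ℝ) / n ≤ 1 := by rw [div_le_one hnpos]; exact hn'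
    have hCK : 0 ≤ C / K := by positivity
    have hinv0 : (0 : ℝ) ≤ 1 / n := by positivity
    rw [Real.norm_eq_abs, Real.norm_eq_abs, abs_of_nonneg hinv0, hratio]
    have e : s * (α / (K * √n)) - 1 = (s - 1) + s * (α / (K * √n) - 1) := by ring
    rw [e]
    calc |(s - 1) + s * (α / (K * √n) - 1)| ≤ |s - 1| + |s * (α / (K * √n) - 1)| := abs_add_le _ _
      _ ≤ 1 / n + 2 * (C / K * (1 / n)) := by
          refine add_le_add ?_ ?_
          · rw [abs_of_nonneg (by linarith)]; linarith
          · rw [abs_mul, abs_of_nonneg (by linarith)]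
            gcongr
            linarith
      _ = _ := by ring
  · filter_upwards [eventually_ge_atTop 1] with n hn
    have := (hbpos n hn).ne'
    change a n = b n * (1 + (a n / b n - 1))
    field_simp
    ring

/-- The series in question is `∑ₖ ∏_{j ≤ k} (1 - e ^ (-j t))`, by the formal strange identity. -/
theorem factorialGrowth_expMul_mul_momentSeries :
    FactorialGrowth (fun m => ((PowerSeries.coeff m (expMul (1 / 24) * momentSeries) : ℚ) : ℝ))
      (6 / Real.pi ^ 2) (12 * √3 / (Real.pi ^ 2 * √Real.pi)) := by
  have hR : 0 < 6 / Real.pi ^ 2 := by have := Real.pi_pos; positivity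
  have h := factorialGrowth_momentSeries.transfer (g := expMul (1 / 24 : ℝ)) (v := 1)
    (B := 1) (G := 1) (μ := 0) hR one_pos zero_le_one le_rfl (map_one _) (by simp [PowerSeries.coeff_one])
    (one_majorized_geom zero_le_one) (constantCoeff_expMul _) ?_
  · rw [mul_one, mul_one, zero_div, Real.exp_zero, mul_one] at h
    convert! h using 2 with n
    rw [mul_comm, PowerSeries.coeff_mul, Finset.Nat.sum_antidiagonal_eq_sum_range_succ_mk,
      Rat.cast_sum]
    refine Finset.sum_congr rfl fun m hm => ?_
    have hm := Nat.lt_succ_iff.mp (Finset.mem_range.mp hm)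
    rw [map_one, one_mul, PowerSeries.coeff_mul_X_pow', if_pos hm, coeff_expMul,
      coeff_expMul]
    push_cast
    simp
  · intro i
    rw [PowerSeries.coeff_C_mul, geom, PowerSeries.coeff_mk, coeff_expMul]
    have : (1 : ℝ) ≤ i.factorial := by exact_mod_cast Nat.factorial_pos i
    have h24 : |(1 / 24 : ℝ) ^ i| ≤ 1 := by
      rw [abs_pow]; exact pow_le_one₀ (abs_nonneg _) (by rw [abs_of_pos] <;> norm_num)
    simp only [one_pow, mul_one]
    rw [abs_mul]
    refine mul_le_one₀ h24 (abs_nonneg _) ?_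
    simp only [eq_ratCast, Rat.cast_div, Rat.cast_one, Rat.cast_natCast]
    rw [abs_of_pos (by positivity), div_le_one (by positivity)]
    exact this

/-- A convergence radius gives geometric bounds for the multiplicities. -/
theorem exists_pow_bound {L : ℕ → ℕ}
    (h : ∃ r : ℝ, 0 < r ∧ Summable fun m : ℕ => (L m : ℝ) * r ^ m) :
    ∃ A : ℝ, 1 ≤ A ∧ ∀ i, (L (i + 1) : ℝ) ≤ A ^ (i + 1) := by
  obtain ⟨r, hr, hs⟩ := h
  set T := ∑' m : ℕ, (L m : ℝ) * r ^ m with hT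
  have hle : ∀ m, (L m : ℝ) * r ^ m ≤ T := fun m => hs.le_tsum m fun j _ => by positivity
  refine ⟨max 1 (max 1 T / r), le_max_left _ _, fun i => ?_⟩
  have h1 : (L (i + 1) : ℝ) ≤ (max 1 T / r) ^ (i + 1) := by
    rw [div_pow, le_div_iff₀ (by positivity)]
    calc _ ≤ T := hle _
      _ ≤ max 1 T := le_max_right _ _
      _ ≤ _ := le_self_pow₀ (le_max_left _ _) (Nat.succ_ne_zero i)
  exact h1.trans (pow_le_pow_left₀ (by positivity) (le_max_right _ _) _)

/-- Here `log f = λ₁ z (1 + μ z + ⋯)` with `μ = (λ₂ - λ₁² / 2) / λ₁`. -/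
theorem factorialGrowth_fishburnSeries {L : ℕ → ℕ} (hL : L 0 = 1) (hL1 : 0 < L 1)
    (h : ∃ r : ℝ, 0 < r ∧ Summable fun m : ℕ => (L m : ℝ) * r ^ m) :
    FactorialGrowth (fun n => ((PowerSeries.coeff n (fishburnSeries (multisetSeries L)) : ℚ) : ℝ))
      (6 / Real.pi ^ 2 * L 1) (12 * √3 / (Real.pi ^ 2 * √Real.pi) *
        Real.exp (Real.pi ^ 2 / 6 * ((L 2 : ℝ) / (L 1 : ℝ) ^ 2 - 1 / 2))) := by
  obtain ⟨A, hA, hLA⟩ := exists_pow_bound h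
  have hf := constantCoeff_multisetSeries hL
  set f := multisetSeries L with hfdef
  have hcoeff : ∀ i, PowerSeries.coeff i f = L i := fun i => by simp [hfdef, multisetSeries]
  have hl : (0 : ℝ) < L 1 := by exact_mod_cast hL1
  have hl1 : (1 : ℝ) ≤ L 1 := by exact_mod_cast hL1
  have hπ := Real.pi_pos
  have hw := abs_coeff_logOf_le hf (zero_le_one.trans hA) (fun i => by
    rw [hcoeff]; push_cast; rw [abs_of_nonneg (by positivity)]; exact hLA i)
  set w : PowerSeries ℝ := PowerSeries.map (algebraMap ℚ ℝ) (PowerSeries.logOf f) with hwdef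
  have hwc : ∀ i, PowerSeries.coeff i w =
      ((PowerSeries.coeff i (PowerSeries.logOf f) : ℚ) : ℝ) := by
    intro i; simp [hwdef, PowerSeries.coeff_map]
  set v : PowerSeries ℝ := PowerSeries.mk fun i => PowerSeries.coeff (i + 1) w / L 1 with hv
  have hwv : w = PowerSeries.C (L 1 : ℝ) * PowerSeries.X * v := by
    ext i
    rw [mul_assoc, PowerSeries.coeff_C_mul]
    cases i with
    | zero =>
      rw [hwc, PowerSeries.coeff_zero_eq_constantCoeff_apply, PowerSeries.constantCoeff_logOf hf]
      simp
    | succ i =>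
      rw [PowerSeries.coeff_succ_X_mul, hv, PowerSeries.coeff_mk]
      field_simp
  have hv0 : PowerSeries.constantCoeff v = 1 := by
    rw [← PowerSeries.coeff_zero_eq_constantCoeff_apply, hv, PowerSeries.coeff_mk, hwc,
      coeff_one_logOf hf, hcoeff]
    push_cast
    exact div_self hl.ne'
  have hvB : Majorized v (geom ((2 * A) ^ 2)) := by
    intro i
    have hgeom : PowerSeries.coeff i (geom ((2 * A) ^ 2)) = ((2 * A) ^ 2) ^ i :=
      PowerSeries.coeff_mk _ _
    rw [hgeom]
    cases i with
    | zero => simp [hv0]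
    | succ i =>
      rw [hv, PowerSeries.coeff_mk, abs_div, abs_of_pos hl, hwc]
      calc _ ≤ |((PowerSeries.coeff (i + 1 + 1) (PowerSeries.logOf f) : ℚ) : ℝ)| :=
            div_le_self (abs_nonneg _) hl1
        _ ≤ (2 * A) ^ (i + 1 + 1) := hw (i + 1)
        _ ≤ (2 * A) ^ (2 * (i + 1)) := pow_le_pow_right₀ (by linarith) (by omega)
        _ = _ := by rw [pow_mul]
  have key := factorialGrowth_expMul_mul_momentSeries.transfer (g := 1) (v := v)
    (B := (2 * A) ^ 2) (G := 1) (μ := ((L 2 : ℝ) - (L 1 : ℝ) ^ 2 / 2) / L 1) (by positivity) hl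
    (by positivity) le_rfl hv0 ?_ hvB (map_one _) ?_
  · convert! key using 1
    · funext n
      rw [coeff_fishburnSeries_eq_sum hf, Rat.cast_sum]
      refine Finset.sum_congr rfl fun m _ => ?_
      rw [one_mul, ← hwv, hwdef, ← map_pow, PowerSeries.coeff_map]
      push_cast
      rfl
    · congr 2
      field_simp
  · rw [hv, PowerSeries.coeff_mk, hwc, coeff_two_logOf hf, hcoeff, hcoeff]
    push_cast
    ring
  · rw [map_one, one_mul]
    exact one_majorized_geom (by positivity)

theorem asympEq_multisetFishburnNumber {L : ℕ → ℕ} (hL : L 0 = 1) (hL1 : 0 < L 1)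
    (h : ∃ r : ℝ, 0 < r ∧ Summable fun m : ℕ => (L m : ℝ) * r ^ m) :
    AsympEq (fun n => (multisetFishburnNumber L n : ℝ))
        (fun n =>
          (12 * Real.sqrt 6 / Real.pi ^ 2 *
            Real.exp (Real.pi ^ 2 / 6 * ((L 2 : ℝ) / (L 1 : ℝ) ^ 2 - 1 / 2))) *
          (6 * (L 1 : ℝ) / (Real.exp 1 * Real.pi ^ 2)) ^ n * (n : ℝ) ^ (n + 1)) := by
  have hπ := Real.pi_pos
  have hl : (0 : ℝ) < L 1 := by exact_mod_cast hL1
  have key := (factorialGrowth_fishburnSeries hL hL1 h).asympEq (by positivity) (by positivity)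
  convert! key using 1
  · funext n
    rw [← multisetFishburnNumber_eq_coeff L hL n]
    push_cast
    rfl
  · funext n
    have h1 : √(2 * Real.pi) = √2 * √Real.pi := Real.sqrt_mul (by norm_num) _
    have h2 : √(6 : ℝ) = √3 * √2 := by rw [← Real.sqrt_mul (by norm_num)]; norm_num
    have h4 : 0 < √Real.pi := Real.sqrt_pos.mpr hπ
    congr 2
    · rw [h1, h2]
      field_simp
    · congr 1
      field_simp

theorem mainTheorem3 :
    (∀ L : ℕ → ℕ, L 0 = 1 → 0 < L 1 →
      (∃ r : ℝ, 0 < r ∧ Summable fun m : ℕ => (L m : ℝ) * r ^ m) →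
      (∀ n : ℕ, (multisetFishburnNumber L n : ℚ) =
        PowerSeries.coeff n (fishburnSeries (multisetSeries L))) ∧
      AsympEq (fun n => (multisetFishburnNumber L n : ℝ))
        (fun n =>
          (12 * Real.sqrt 6 / Real.pi ^ 2 *
            Real.exp (Real.pi ^ 2 / 6 * ((L 2 : ℝ) / (L 1 : ℝ) ^ 2 - 1 / 2))) *
          (6 * (L 1 : ℝ) / (Real.exp 1 * Real.pi ^ 2)) ^ n * (n : ℝ) ^ (n + 1))) ∧
    (∀ n : ℕ, (fishburnNumber n : ℚ) = PowerSeries.coeff n zagierSeries) ∧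
    AsympEq (fun n => (fishburnNumber n : ℝ))
      (fun n =>
        (12 * Real.sqrt 6 / Real.pi ^ 2 * Real.exp (Real.pi ^ 2 / 12)) *
        (6 / (Real.exp 1 * Real.pi ^ 2)) ^ n * (n : ℝ) ^ (n + 1)) := by
  refine ⟨fun L hL hL1 h => ⟨multisetFishburnNumber_eq_coeff L hL,
    asympEq_multisetFishburnNumber hL hL1 h⟩, fun n => ?_, ?_⟩
  · rw [fishburnNumber_eq, multisetFishburnNumber_eq_coeff _ rfl, fishburnSeries_one]
  · have h := asympEq_multisetFishburnNumber (L := fun _ => 1) rfl one_pos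
      ⟨1 / 2, by norm_num, by simpa using summable_geometric_two⟩
    convert! h using 1
    · funext n
      rw [fishburnNumber_eq]
    · funext n
      congr 3
      · congr 1
        norm_num
        ring
      · norm_num
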